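/- Let $r\ge 1$, let $\mathbf n=(n_1,\dots,n_r)$ be positive integers, let $m\ge 0$, and put $V=\mathbb C^{n_1}\otimes\cdots\otimes\mathbb C^{n_r}$ (tensor product over $\mathbb C$), on which $K=U(n_1)\times\cdots\times U(n_r)$ acts by $(u_1,\dots,u_r)\cdot(v_1\otimes\cdots\otimes v_r)=u_1v_1\otimes\cdots\otimes u_rv_r$. Let $\mathcal P_{\mathbb R}^{d}(V)$ be the complex vector space of complex valued polynomial functions on $V$, regarded as a real vector space, that are homogeneous of degree $d$, and let $\mathcal P_{\mathbb R}^{d}(V)^K$ be the subspace of those $f$ with $f(g^{-1}v)=f(v)$ for all $g\in K$, $v\in V$. Let $x^{i_1\cdots i_r}$ ($1\le i_k\le n_k$) be the coordinate functions on $V$ with respect to the standard basis $e_{i_1}\otimes\cdots\otimes e_{i_r}$, and let $y_{i_1\cdots i_r}=\overline{x^{i_1\cdots i_r}}$. For $(\sigma_1,\dots,\sigma_{r-1})\in S_m^{r-1}$ define $$ f_{[\sigma_1,\dots,\sigma_{r-1}]}=\sum_{I_1,\dots,I_m}\ \prod_{j=1}^m x^{I_j}\ \prod_{j=1}^m y_{\,i^{(\sigma_1(j))}_1\cdots\,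 i^{(\sigma_{r-1}(j))}_{r-1}\, i^{(j)}_r}, $$ where the sum is over all $I_j=(i^{(j)}_1,\dots,i^{(j)}_r)$ with $1\le i^{(j)}_k\le n_k$. This function depends only on the class $[\sigma_1,\dots,\sigma_{r-1}]$ of the tuple under simultaneous conjugation $(\tau\sigma_1\tau^{-1},\dots,\tau\sigma_{r-1}\tau^{-1})$, $\tau\in S_m$. Then: (1) The complex linear span of the functions $f_{[\sigma_1,\dots,\sigma_{r-1}]}$, over all classes of $S_m^{r-1}$ under simultaneous conjugation by $S_m$, equals $\mathcal P_{\mathbb R}^{2m}(V)^{K}$. (2) If $m\ge1$ and $G$ is a finite connected simple graph with first Betti number $|E(G)|-|V(G)|+1=r-1$, then there is a bijection between the set of classes of $S_m^{r-1}$ under simultaneous conjugation by $S_m$ and the set of isomorphism classes of $m$-fold coverings of $G$. Here an $m$-fold covering of $G$ is a simple graph $\tilde G$ with a surjective, $m$-to-one map $p:V(\tilde G)\to V(G)$ that maps the neighborhood of each vertex $w$ of $\tilde G$ bijectively onto the neighborhood of $p(w)$, and coverings $p_1,p_2$ are isomorphic if there is a graph isomorphism $\Phi$ between the covering graphs with $p_2\circ\Phi=p_1$.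 -/

import Mathlib

open scoped TensorProduct

noncomputable section

namespace Entanglement

/-! ### Polynomial functions on the underlying real vector space -/

/-- The space of complex valued polynomial functions, homogeneous of degree `d`, on a complex vector
space `V` regarded as a real vector space: the complex span of the products of `d` real-linear
functions `V → ℂ`. -/
def realPoly (V : Type*) [AddCommGroup V] [Module ℂ V] (d : ℕ) : Submodule ℂ (V → ℂ) :=
  Submodule.span ℂ (Set.range fun (l : Fin d → (V →ₗ[ℝ] ℂ)) (v : V) => ∏ i, l i v)

/-- The functions in `realPoly V d` that are invariant under a group acting linearly on `V`; an
element `g` acts on functions by `(g • f) v = f (g⁻¹ • v)`. -/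
def invariantRealPoly {K V : Type*} [Group K] [AddCommGroup V] [Module ℂ V]
    (ρ : Representation ℂ K V) (d : ℕ) : Submodule ℂ (V → ℂ) where
  carrier := {f | f ∈ realPoly V d ∧ ∀ (g : K) (v : V), f (ρ g⁻¹ v) = f v}
  add_mem' {f f'} hf hf' :=
    ⟨add_mem hf.1 hf'.1, fun g v => by simp only [Pi.add_apply, hf.2 g v, hf'.2 g v]⟩
  zero_mem' := ⟨zero_mem _, fun _ _ => rfl⟩
  smul_mem' c f hf :=
    ⟨Submodule.smul_mem _ c hf.1, fun g v => by simp only [Pi.smul_apply, hf.2 g v]⟩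

/-! ### The tensor product and the product of unitary groups -/

/-- `ℂ^{n_1} ⊗ ⋯ ⊗ ℂ^{n_r}`, the tensor product being over `ℂ`. -/
abbrev TensorSpace {r : ℕ} (n : Fin r → ℕ) : Type :=
  ⨂[ℂ] k : Fin r, (Fin (n k) → ℂ)

/-- `U(n_1) × ⋯ × U(n_r)`. -/
abbrev UnitaryProduct {r : ℕ} (n : Fin r → ℕ) : Type :=
  ∀ k : Fin r, Matrix.unitaryGroup (Fin (n k)) ℂ

/-- The action `(u_1, …, u_r) • (v_1 ⊗ ⋯ ⊗ v_r) = (u_1 v_1) ⊗ ⋯ ⊗ (u_r v_r)`. -/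
def tensorRep {r : ℕ} (n : Fin r → ℕ) :
    Representation ℂ (UnitaryProduct n) (TensorSpace n) where
  toFun u := PiTensorProduct.map fun k => Matrix.toLin' (u k : Matrix (Fin (n k)) (Fin (n k)) ℂ)
  map_one' := by
    simp only [Pi.one_apply, OneMemClass.coe_one, Matrix.toLin'_one]
    exact PiTensorProduct.map_id
  map_mul' u w := by
    simp only [Pi.mul_apply, Submonoid.coe_mul, Matrix.toLin'_mul]
    exact PiTensorProduct.map_comp _ _

/-- The coordinate function `x^{i_1 ⋯ i_r}`: the coefficient at `e_{i_1} ⊗ ⋯ ⊗ e_{i_r}` in the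
standard basis of the tensor product. -/
def xCoord {r : ℕ} (n : Fin r → ℕ) (i : ∀ k, Fin (n k)) (v : TensorSpace n) : ℂ :=
  (Basis.piTensorProduct fun k => Pi.basisFun ℂ (Fin (n k))).repr v i

/-- The function `y_{i_1 ⋯ i_r}`, the complex conjugate of `x^{i_1 ⋯ i_r}`. -/
def yCoord {r : ℕ} (n : Fin r → ℕ) (i : ∀ k, Fin (n k)) (v : TensorSpace n) : ℂ :=
  starRingEnd ℂ (xCoord n i v)

/-! ### The invariants attached to tuples of permutations

There are `r = s + 1` tensor factors and `s = r - 1` permutations. -/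

/-- The tuple `(σ_1, …, σ_{r-1}, 1)`. -/
def extendOne {s m : ℕ} (σ : Fin s → Equiv.Perm (Fin m)) : Fin (s + 1) → Equiv.Perm (Fin m) :=
  Fin.snoc (α := fun _ => Equiv.Perm (Fin m)) σ 1

/-- The sum over all `I_1, …, I_m`, where `I_j = (i^{(j)}_1, …, i^{(j)}_r)`, of
`∏_j x^{I_j} * ∏_j y_{i^{(σ_1(j))}_1 ⋯ i^{(σ_{r-1}(j))}_{r-1} i^{(j)}_r}`. -/
def permInvariant {s : ℕ} (n : Fin (s + 1) → ℕ) {m : ℕ} (σ : Fin s → Equiv.Perm (Fin m)) :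
    TensorSpace n → ℂ := fun v =>
  ∑ I : Fin m → (∀ k, Fin (n k)),
    (∏ j, xCoord n (I j) v) * ∏ j, yCoord n (fun k => I (extendOne σ k j) k) v

/-- Simultaneous conjugacy of tuples of permutations. -/
def simConj (s m : ℕ) : Setoid (Fin s → Equiv.Perm (Fin m)) where
  r σ σ' := ∃ τ : Equiv.Perm (Fin m), ∀ k, σ' k = τ * σ k * τ⁻¹
  iseqv :=
    { refl := fun σ => ⟨1, fun k => by simp⟩
      symm := by
        rintro σ σ' ⟨τ, h⟩
        exact ⟨τ⁻¹, fun k => by rw [h]; group⟩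
      trans := by
        rintro σ σ' σ'' ⟨τ, h⟩ ⟨τ', h'⟩
        exact ⟨τ' * τ, fun k => by rw [h', h]; group⟩ }

/-- The set of classes `[σ_1, …, σ_s]` of `s`-tuples in `S_m` under simultaneous conjugation. -/
abbrev PermClass (s m : ℕ) : Type := Quotient (simConj s m)

theorem permInvariant_conj {s : ℕ} (n : Fin (s + 1) → ℕ) {m : ℕ}
    (σ σ' : Fin s → Equiv.Perm (Fin m)) (h : simConj s m σ σ') :
    permInvariant n σ = permInvariant n σ' := by
  obtain ⟨τ, h⟩ := h
  have hext : ∀ k j, extendOne σ' k (τ j) = τ (extendOne σ k j) := by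
    intro k j
    refine Fin.lastCases ?_ (fun k => ?_) k
    · simp [extendOne]
    · simp [extendOne, h]
  funext v
  refine (Fintype.sum_equiv (Equiv.arrowCongr τ (Equiv.refl (∀ k, Fin (n k)))) _ _ ?_)
  intro I
  congr 1
  · exact Fintype.prod_equiv τ _ _ fun j => by simp
  · exact Fintype.prod_equiv τ _ _ fun j => by simp [hext]

/-- The invariant `f_{[σ_1, …, σ_{r-1}]}` of a class of tuples. -/
def classInvariant {s : ℕ} (n : Fin (s + 1) → ℕ) {m : ℕ} (c : PermClass s m) :
    TensorSpace n → ℂ :=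
  Quotient.lift (permInvariant n) (permInvariant_conj n) c

/-! ### Graph coverings -/

universe u

/-- The first Betti number `|E| - |V| + 1` of a finite connected graph. -/
def bettiNumber {V : Type u} (G : SimpleGraph V) : ℤ :=
  (Nat.card G.edgeSet : ℤ) - (Nat.card V : ℤ) + 1

/-- An `m`-fold covering of the graph `G`: a graph with a surjection onto the vertices of `G` which
maps the neighborhood of each vertex bijectively onto the neighborhood of its image, and each of
whose fibres has exactly `m` elements. -/
structure GraphCovering {V : Type u} (G : SimpleGraph V) (m : ℕ) : Type (u + 1) where
  /-- the vertices of the covering graph -/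
  vertices : Type u
  /-- the covering graph -/
  graph : SimpleGraph vertices
  /-- the projection -/
  proj : vertices → V
  surjective : Function.Surjective proj
  bijOn : ∀ w, Set.BijOn proj (graph.neighborSet w) (G.neighborSet (proj w))
  fold : ∀ v, (proj ⁻¹' {v}).encard = m

/-- Isomorphism of coverings: a graph isomorphism compatible with the projections. -/
def coveringIso {V : Type u} (G : SimpleGraph V) (m : ℕ) : Setoid (GraphCovering G m) where
  r p q := ∃ Φ : p.graph ≃g q.graph, ∀ w, q.proj (Φ w) = p.proj w
  iseqv :=
    { refl := fun p => ⟨SimpleGraph.Iso.refl, fun _ => rfl⟩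
      symm := by
        rintro p q ⟨Φ, h⟩
        exact ⟨Φ.symm, fun w => by rw [← h (Φ.symm w), RelIso.apply_symm_apply]⟩
      trans := by
        rintro p q t ⟨Φ, h⟩ ⟨Ψ, h'⟩
        exact ⟨Φ.trans Ψ, fun w => by rw [← h w, ← h' (Φ w)]; rfl⟩ }

/-- The isomorphism classes of `m`-fold coverings of `G`. -/
abbrev CoveringClass {V : Type u} (G : SimpleGraph V) (m : ℕ) : Type (u + 1) :=
  Quotient (coveringIso G m)

end Entanglement

end

/-!
The first part is the first fundamental theorem of invariant theory for a product of unitary groups.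
An invariant polynomial function is in particular invariant under the scalars of modulus one, so it
has equal degrees in `x` and in `y` (`mem_range_tensorFormMap`) and is of the form
`v ↦ ⟨v^{⊗m}, M v^{⊗m}⟩` for a matrix `M` acting on the `m`-th tensor power. When `M` is symmetrized
over the permutations of the `m` tensor factors, it is determined by the function
(`eq_zero_of_tensorForm_eq_zero`), because a polynomial in `z` and `conj z` that vanishes identically
has zero coefficients. Invariance of the function therefore means that `M` commutes with the tensor
powers of `u_1 ⊗ ⋯ ⊗ u_r` for all unitary `u_k`. Products of unitary groups are Zariski dense in the
products of matrix spaces (`eq_zero_of_eval_unitary_eq_zero`), so `M` commutes with the tensor power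
of generic matrices, hence with the commutant of the finite group `S_m^r` acting on the basis
(`commute_of_commute_kronPow`). By the double commutant theorem for a finite group of permutations
(`mem_span_permOperator`), `M` is a linear combination of elements of `S_m^r`; renumbering the
factors `y` makes the last of the `r` permutations trivial, which gives the functions
`permInvariant`.

For the second part, choose a spanning tree of `G`, consisting of the edges from each vertex to its
parent on a shortest path to a root. The edges outside of it are `s` in number
(`exists_cotree_edges`). Attaching a permutation of the `m` sheets to each of these, and the identity
to the edges of the tree, defines a covering (`voltageCovering`, `tupleVoltage`). Every covering
arises in this way: number the sheets over the root and carry the numbering along the tree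
(`exists_tupleVoltage_iso`). An isomorphism permutes the sheets in the same way over all vertices,
because it is compatible with the tree, so it is a simultaneous conjugation
(`tupleVoltage_iso_iff`).
-/

namespace Entanglement

/-! ### Zariski density of real forms and of unitary groups -/

section Density

open MvPolynomial

/-- A polynomial that vanishes on the points `(conj z, z)` is zero: `z = a + i b` and
`conj z = a - i b` are independent once the real coordinates `a`, `b` are replaced by complex
ones. -/
theorem eq_zero_of_eval_conj_eq_zero {ι : Type*} (P : MvPolynomial (ι ⊕ ι) ℂ)
    (h : ∀ z : ι → ℂ, eval (Sum.elim (star z) z) P = 0) : P = 0 := by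
  -- the substitution of `a - i b` and `a + i b` for the two groups of variables
  let q : ι ⊕ ι → MvPolynomial (ι ⊕ ι) ℂ :=
    Sum.elim (fun i => X (Sum.inl i) - C Complex.I * X (Sum.inr i))
      fun i => X (Sum.inl i) + C Complex.I * X (Sum.inr i)
  have heval : ∀ c : ι ⊕ ι → ℂ, eval c (bind₁ q P) = eval (fun i => eval c (q i)) P := by
    intro c
    rw [eval, eval₂Hom_bind₁]
    rfl
  have hq : bind₁ q P = 0 := by
    refine funext_set (fun _ => Set.range ((↑) : ℝ → ℂ))
      (fun _ => Set.infinite_range_of_injective Complex.ofReal_injective) fun c hc => ?_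
    rw [heval, map_zero, ← h fun i => c (Sum.inl i) + Complex.I * c (Sum.inr i)]
    congr 2
    funext i
    have hreal : ∀ i, star (c i) = c i := by
      intro i
      obtain ⟨t, ht⟩ := hc i trivial
      rw [← ht]
      exact Complex.conj_ofReal t
    rcases i with i | i
    · simp [q, hreal, sub_eq_add_neg]
    · simp [q]
  refine MvPolynomial.funext fun c => ?_
  have := heval (Sum.elim (fun i => (c (Sum.inr i) + c (Sum.inl i)) / 2)
    fun i => (c (Sum.inr i) - c (Sum.inl i)) / (2 * Complex.I))
  rw [hq, map_zero] at this
  rw [map_zero, this]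
  congr 2
  funext i
  have hI := Complex.I_ne_zero
  rcases i with i | i <;> simp [q] <;> field_simp <;> ring

variable {ι : Type*} {N : ι → Type*}

/-- The family of all entries of a family of square matrices. -/
def matrixEntries (g : ∀ k, Matrix (N k) (N k) ℂ) : (Σ k, N k × N k) → ℂ :=
  fun e => g e.1 e.2.1 e.2.2

variable [∀ k, Fintype (N k)] [∀ k, DecidableEq (N k)]

theorem infinite_unit_circle : {z : ℂ | star z * z = 1}.Infinite := by
  have : Infinite Circle := Circle.argEquiv.infinite_iff.mpr
    (Set.infinite_coe_iff.mpr (Set.Ioc_infinite (by linarith [Real.pi_pos])))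
  refine (Set.infinite_range_of_injective (α := Circle) Circle.coe_injective).mono ?_
  rintro _ ⟨z, rfl⟩
  change (starRingEnd ℂ) (z : ℂ) * z = 1
  rw [← Circle.coe_inv_eq_conj, ← Circle.coe_mul, inv_mul_cancel, Circle.coe_one]

theorem eval_entries_conj_diagonal (P : MvPolynomial (Σ k, N k × N k) ℂ)
    (h : ∀ u : ∀ k, Matrix.unitaryGroup (N k) ℂ,
      eval (matrixEntries fun k => (u k : Matrix (N k) (N k) ℂ)) P = 0)
    (U : ∀ k, Matrix.unitaryGroup (N k) ℂ) (D : ∀ k, N k → ℂ) :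
    eval (matrixEntries fun k => (U k : Matrix (N k) (N k) ℂ) * Matrix.diagonal (D k) *
      star (U k : Matrix (N k) (N k) ℂ)) P = 0 := by
  let q : (Σ k, N k × N k) → MvPolynomial (Σ k, N k) ℂ := fun e =>
    ∑ a, C ((U e.1 : Matrix (N e.1) (N e.1) ℂ) e.2.1 a) * X ⟨e.1, a⟩ *
      C ((star (U e.1 : Matrix (N e.1) (N e.1) ℂ)) a e.2.2)
  have heval : ∀ D : ∀ k, N k → ℂ, eval (fun e : Σ k, N k => D e.1 e.2) (bind₁ q P) =
      eval (matrixEntries fun k => (U k : Matrix (N k) (N k) ℂ) * Matrix.diagonal (D k) *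
        star (U k : Matrix (N k) (N k) ℂ)) P := by
    intro D
    rw [eval, eval₂Hom_bind₁]
    change eval (fun e => eval _ (q e)) P = _
    congr 2
    funext ⟨k, i, j⟩
    simp [q, matrixEntries, Matrix.mul_apply, Matrix.diagonal_apply]
  have hq : bind₁ q P = 0 := by
    refine funext_set (fun _ => {z : ℂ | star z * z = 1}) (fun _ => infinite_unit_circle)
      fun c hc => ?_
    have hD : ∀ k, Matrix.diagonal (fun a => c ⟨k, a⟩) ∈ Matrix.unitaryGroup (N k) ℂ := by
      intro k
      rw [Matrix.mem_unitaryGroup_iff', Matrix.star_eq_conjTranspose,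
        Matrix.diagonal_conjTranspose, Matrix.diagonal_mul_diagonal, ← Matrix.diagonal_one]
      congr 1
      funext a
      exact hc ⟨k, a⟩ trivial
    rw [map_zero]
    have hc' := heval fun k a => c ⟨k, a⟩
    rw [hc']
    have := h fun k => U k * ⟨_, hD k⟩ * star (U k)
    simpa only [Submonoid.coe_mul, Unitary.coe_star] using this
  rw [← heval, hq, map_zero]

/-- Products of unitary groups are Zariski dense in the corresponding products of matrix spaces.
A polynomial that vanishes on the unitary matrices vanishes on `U D U⋆` for diagonal `D`, since the
torus of unitary diagonal matrices is Zariski dense; so it vanishes on the Hermitian matrices, of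
which the complex span is everything. -/
theorem eq_zero_of_eval_unitary_eq_zero (P : MvPolynomial (Σ k, N k × N k) ℂ)
    (h : ∀ u : ∀ k, Matrix.unitaryGroup (N k) ℂ,
      eval (matrixEntries fun k => (u k : Matrix (N k) (N k) ℂ)) P = 0) : P = 0 := by
  have hherm : ∀ A : ∀ k, Matrix (N k) (N k) ℂ, (∀ k, (A k).IsHermitian) →
      eval (matrixEntries A) P = 0 := by
    intro A hA
    rw [← eval_entries_conj_diagonal P h (fun k => (hA k).eigenvectorUnitary)
      fun k => RCLike.ofReal ∘ (hA k).eigenvalues]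
    have : A = fun k => ((hA k).eigenvectorUnitary : Matrix (N k) (N k) ℂ) *
        Matrix.diagonal (RCLike.ofReal ∘ (hA k).eigenvalues) *
        star ((hA k).eigenvectorUnitary : Matrix (N k) (N k) ℂ) :=
      funext fun k => (hA k).spectral_theorem
    rw [← this]
  have hlin : ∀ A B : ∀ k, Matrix (N k) (N k) ℂ, (∀ k, (A k).IsHermitian) →
      (∀ k, (B k).IsHermitian) → ∀ z : ℂ, eval (matrixEntries fun k => A k + z • B k) P = 0 := by
    intro A B hA hB
    let p : Polynomial ℂ := aeval (fun e => Polynomial.C (matrixEntries A e) +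
      Polynomial.X * Polynomial.C (matrixEntries B e)) P
    have hp : ∀ z, p.eval z = eval (matrixEntries fun k => A k + z • B k) P := by
      intro z
      have : (Polynomial.evalRingHom z).comp
          (aeval (fun e => Polynomial.C (matrixEntries A e) +
            Polynomial.X * Polynomial.C (matrixEntries B e)) :
            MvPolynomial (Σ k, N k × N k) ℂ →ₐ[ℂ] Polynomial ℂ).toRingHom =
          eval (matrixEntries fun k => A k + z • B k) := by
        ext e
        · simp
        · simpa [matrixEntries] using mul_comm _ _
      exact congrArg (fun f : MvPolynomial (Σ k, N k × N k) ℂ →+* ℂ => f P) this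
    have hp0 : p = 0 := by
      refine Polynomial.eq_zero_of_infinite_isRoot p
        ((Set.infinite_range_of_injective Complex.ofReal_injective).mono ?_)
      rintro _ ⟨t, rfl⟩
      change p.eval _ = 0
      rw [hp]
      refine hherm _ fun k => (hA k).add ?_
      rw [Matrix.IsHermitian, Matrix.conjTranspose_smul, (hB k).eq]
      congr 1
      exact Complex.conj_ofReal t
    intro z
    rw [← hp, hp0, Polynomial.eval_zero]
  refine MvPolynomial.funext fun c => ?_
  let g : ∀ k, Matrix (N k) (N k) ℂ := fun k i j => c ⟨k, i, j⟩
  have := hlin (fun k => (realPart (g k) : Matrix (N k) (N k) ℂ))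
    (fun k => (imaginaryPart (g k) : Matrix (N k) (N k) ℂ))
    (fun k => (realPart (g k)).2) (fun k => (imaginaryPart (g k)).2) Complex.I
  simp only [realPart_add_I_smul_imaginaryPart] at this
  rw [map_zero, ← this]
  rfl

end Density

/-! ### The double commutant of a finite permutation group -/

section DoubleCommutant

variable {H X : Type*} [Group H] [DecidableEq X]

/-- The matrix of a permutation, as an operator on functions: it sends the basis vector at `y` to
the basis vector at `π y`. -/
noncomputable def permOperator (π : Equiv.Perm X) : Matrix X X ℂ :=
  fun x y => if x = π y then 1 else 0

theorem permOperator_one : permOperator (1 : Equiv.Perm X) = 1 := by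
  ext x y
  simp only [permOperator, Matrix.one_apply, Equiv.Perm.one_apply]
  congr 1

variable [Fintype X]

theorem permOperator_mul_apply (π : Equiv.Perm X) (M : Matrix X X ℂ) (x y : X) :
    (permOperator π * M) x y = M (π⁻¹ x) y := by
  simp [Matrix.mul_apply, permOperator, ← Equiv.symm_apply_eq, Equiv.Perm.inv_def]

theorem mul_permOperator_apply (π : Equiv.Perm X) (M : Matrix X X ℂ) (x y : X) :
    (M * permOperator π) x y = M x (π y) := by
  simp [Matrix.mul_apply, permOperator]

theorem permOperator_mul (π π' : Equiv.Perm X) :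
    permOperator (π * π') = permOperator π * permOperator π' := by
  ext x y
  rw [permOperator_mul_apply]
  simp only [permOperator, Equiv.Perm.mul_apply, Equiv.Perm.inv_eq_iff_eq]
  congr 1

/-- A matrix that commutes with everything commuting with a finite group of permutations is a
linear combination of these permutations. The averaged projection `p` of the matrix space onto the
span of the permutations has blocks that commute with the group, so it commutes with left
multiplication by `M`, and `M = M * p 1 = p M`. -/
theorem mem_span_permOperator [Finite H] (φ : H →* Equiv.Perm X) (M : Matrix X X ℂ)
    (hM : ∀ N : Matrix X X ℂ, (∀ h x y, N (φ h x) (φ h y) = N x y) → M * N = N * M) :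
    M ∈ Submodule.span ℂ (Set.range fun h => permOperator (φ h)) := by
  have := Fintype.ofFinite H
  let A : Submodule ℂ (Matrix X X ℂ) := Submodule.span ℂ (Set.range fun h => permOperator (φ h))
  have hA : ∀ h, ∀ N ∈ A, permOperator (φ h) * N ∈ A := by
    intro h N hN
    induction hN using Submodule.span_induction with
    | mem N hN =>
      obtain ⟨h', rfl⟩ := hN
      exact Submodule.subset_span ⟨h * h', by simp only [map_mul, permOperator_mul]⟩
    | zero => simp
    | add N N' _ _ h1 h2 => rw [mul_add]; exact add_mem h1 h2
    | smul c N _ h1 => rw [Matrix.mul_smul]; exact A.smul_mem c h1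
  obtain ⟨π, hπ⟩ := A.subtype.exists_leftInverse_of_injective A.ker_subtype
  let L : H → Matrix X X ℂ →ₗ[ℂ] Matrix X X ℂ := fun h =>
    LinearMap.mulLeft ℂ (permOperator (φ h))
  let p : Matrix X X ℂ →ₗ[ℂ] Matrix X X ℂ :=
    (Fintype.card H : ℂ)⁻¹ • ∑ h, L h ∘ₗ A.subtype ∘ₗ π ∘ₗ L h⁻¹
  have hp : ∀ N, p N = (Fintype.card H : ℂ)⁻¹ •
      ∑ h, permOperator (φ h) * (π (permOperator (φ h⁻¹) * N) : Matrix X X ℂ) := by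
    intro N
    simp [p, L]
  have hpA : ∀ N, p N ∈ A := by
    intro N
    rw [hp]
    exact A.smul_mem _ (A.sum_mem fun h _ => hA h _ (π _).2)
  have hp1 : p 1 = 1 := by
    have h1 : ∀ h, (π (permOperator (φ h⁻¹) * 1) : Matrix X X ℂ) = permOperator (φ h⁻¹) := by
      intro h
      have := LinearMap.congr_fun hπ ⟨permOperator (φ h⁻¹), Submodule.subset_span ⟨h⁻¹, rfl⟩⟩
      rw [mul_one]
      exact congrArg Subtype.val this
    rw [hp]
    simp only [h1, ← permOperator_mul, ← map_mul, mul_inv_cancel, map_one, permOperator_one,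
      Finset.sum_const, Finset.card_univ, ← Nat.cast_smul_eq_nsmul ℂ, smul_smul]
    rw [inv_mul_cancel₀ (Nat.cast_ne_zero.mpr Fintype.card_ne_zero), one_smul]
  -- averaging over the group makes `p` equivariant
  have hpL : ∀ h N, p (permOperator (φ h) * N) = permOperator (φ h) * p N := by
    intro h N
    rw [hp, hp, Matrix.mul_smul, Finset.mul_sum]
    congr 1
    refine Fintype.sum_equiv (Equiv.mulLeft h⁻¹) _ _ fun h' => ?_
    simp only [Equiv.coe_mulLeft, ← mul_assoc, ← permOperator_mul, ← map_mul, mul_inv_rev,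
      inv_inv, mul_inv_cancel, one_mul]
  -- The entries of `p` with fixed column indices `a`, `b` form a matrix commuting with the group.
  let B : X → X → Matrix X X ℂ := fun a b => Matrix.of fun x y => p (Matrix.single y b 1) x a
  have hBp : ∀ a b x y, B a b x y = p (Matrix.single y b 1) x a := fun _ _ _ _ => rfl
  have hB : ∀ a b h x y, B a b (φ h x) (φ h y) = B a b x y := by
    intro a b h x y
    have h1 : Matrix.single (φ h y) b (1 : ℂ) = permOperator (φ h) * Matrix.single y b 1 := by
      ext z c
      rw [permOperator_mul_apply]
      simp only [Matrix.single_apply, Equiv.Perm.eq_inv_iff_eq]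
    rw [hBp, hBp, h1, hpL, permOperator_mul_apply, Equiv.Perm.inv_def, Equiv.symm_apply_apply]
  have hpB : ∀ N x a, p N x a = ∑ b, (B a b * N) x b := by
    intro N x a
    conv_lhs => rw [Matrix.matrix_eq_sum_single N]
    have h1 : ∀ y b, Matrix.single y b (N y b) = N y b • Matrix.single y b 1 := by
      intro y b
      rw [Matrix.smul_single, smul_eq_mul, mul_one]
    simp only [h1, map_sum, map_smul, Matrix.sum_apply, Matrix.smul_apply, Matrix.mul_apply, hBp,
      smul_eq_mul]
    rw [Finset.sum_comm]
    simp only [mul_comm]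
  have hMp : M = p M := by
    ext x a
    calc M x a = (M * p 1) x a := by rw [hp1, mul_one]
      _ = ∑ z, ∑ b, M x z * B a b z b := by
        simp only [Matrix.mul_apply (M := M), hpB, mul_one, Finset.mul_sum]
      _ = ∑ b, (M * B a b) x b := by
        rw [Finset.sum_comm]
        simp only [Matrix.mul_apply]
      _ = ∑ b, (B a b * M) x b := by
        simp only [fun b => hM (B a b) (hB a b)]
      _ = p M x a := (hpB M x a).symm
  rw [hMp]
  exact hpA M

end DoubleCommutant

/-! ### Tensor powers in coordinates -/

section TensorPowers

variable {r m : ℕ} {n : Fin r → ℕ}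

/-- Indices of the standard basis of `ℂ^{n_1} ⊗ ⋯ ⊗ ℂ^{n_r}`. -/
abbrev MultiIndex (n : Fin r → ℕ) : Type := ∀ k, Fin (n k)

/-- The Kronecker product `g_1 ⊗ ⋯ ⊗ g_r`. -/
def kronMatrix (g : ∀ k, Matrix (Fin (n k)) (Fin (n k)) ℂ) :
    Matrix (MultiIndex n) (MultiIndex n) ℂ :=
  Matrix.of fun a c => ∏ k, g k (a k) (c k)

/-- The `m`-th tensor power of `g_1 ⊗ ⋯ ⊗ g_r`. -/
def kronPow (m : ℕ) (g : ∀ k, Matrix (Fin (n k)) (Fin (n k)) ℂ) :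
    Matrix (Fin m → MultiIndex n) (Fin m → MultiIndex n) ℂ :=
  Matrix.of fun A C => ∏ j, ∏ k, g k (A j k) (C j k)

/-- The coordinates of the `m`-th tensor power of the vector with coordinates `z`. -/
def tensorPow (m : ℕ) (z : MultiIndex n → ℂ) : (Fin m → MultiIndex n) → ℂ :=
  fun A => ∏ j, z (A j)

/-- The function `z ↦ ⟨z^{⊗m}, M z^{⊗m}⟩`, linear in the matrix `M`. -/
def tensorForm (M : Matrix (Fin m → MultiIndex n) (Fin m → MultiIndex n) ℂ)
    (z : MultiIndex n → ℂ) : ℂ :=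
  star (tensorPow m z) ⬝ᵥ (M.mulVec (tensorPow m z))

/-- The action of `S_m^r`: the `k`-th permutation moves the `k`-th entries of a sequence of `m`
multi-indices. -/
def indexPerm (n : Fin r → ℕ) (m : ℕ) :
    (Fin r → Equiv.Perm (Fin m)) →* Equiv.Perm (Fin m → MultiIndex n) where
  toFun h :=
    { toFun := fun A j k => A ((h k)⁻¹ j) k
      invFun := fun A j k => A (h k j) k
      left_inv := fun A => by simp
      right_inv := fun A => by simp }
  map_one' := rfl
  map_mul' h h' := rfl

theorem indexPerm_apply (h : Fin r → Equiv.Perm (Fin m)) (A : Fin m → MultiIndex n) :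
    indexPerm n m h A = fun j k => A ((h k)⁻¹ j) k := rfl

/-- The operator of an element of the diagonal copy of `S_m` in `S_m^r`, which permutes the `m` tensor
factors of the `m`-th tensor power. -/
noncomputable def sheetOperator (n : Fin r → ℕ) (σ : Equiv.Perm (Fin m)) :
    Matrix (Fin m → MultiIndex n) (Fin m → MultiIndex n) ℂ :=
  permOperator (indexPerm n m fun _ => σ)

theorem kronPow_mul (g h : ∀ k, Matrix (Fin (n k)) (Fin (n k)) ℂ) :
    kronPow m (fun k => g k * h k) = kronPow m g * kronPow m h := by
  ext A C
  simp only [kronPow, Matrix.of_apply, Matrix.mul_apply, Fintype.prod_sum,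
    ← Finset.prod_mul_distrib]

theorem kronPow_one : kronPow m (fun k => (1 : Matrix (Fin (n k)) (Fin (n k)) ℂ)) = 1 := by
  ext A C
  simp only [kronPow, Matrix.of_apply, Matrix.one_apply, Finset.prod_ite_zero, Finset.mem_univ,
    forall_const, Finset.prod_const_one, ← funext_iff]

theorem kronPow_conjTranspose (g : ∀ k, Matrix (Fin (n k)) (Fin (n k)) ℂ) :
    (kronPow m g).conjTranspose = kronPow m fun k => star (g k) := by
  ext A C
  simp [kronPow, Matrix.star_apply]

theorem kronPow_conjTranspose_mul_self (u : UnitaryProduct n) :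
    (kronPow m fun k => (u k : Matrix (Fin (n k)) (Fin (n k)) ℂ)).conjTranspose *
      (kronPow m fun k => (u k : Matrix (Fin (n k)) (Fin (n k)) ℂ)) = 1 := by
  rw [kronPow_conjTranspose, ← kronPow_mul]
  simp only [Unitary.coe_star_mul_self]
  exact kronPow_one

theorem tensorPow_mulVec (g : ∀ k, Matrix (Fin (n k)) (Fin (n k)) ℂ) (z : MultiIndex n → ℂ) :
    tensorPow m ((kronMatrix g).mulVec z) = (kronPow m g).mulVec (tensorPow m z) := by
  funext A
  simp only [tensorPow, kronMatrix, kronPow, Matrix.mulVec, dotProduct, Matrix.of_apply,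
    Fintype.prod_sum, ← Finset.prod_mul_distrib]

theorem tensorForm_mulVec (M : Matrix (Fin m → MultiIndex n) (Fin m → MultiIndex n) ℂ)
    (g : ∀ k, Matrix (Fin (n k)) (Fin (n k)) ℂ) (z : MultiIndex n → ℂ) :
    tensorForm M ((kronMatrix g).mulVec z) =
      tensorForm ((kronPow m g).conjTranspose * M * kronPow m g) z := by
  simp only [tensorForm, tensorPow_mulVec, Matrix.star_mulVec, ← Matrix.mulVec_mulVec,
    ← Matrix.dotProduct_mulVec]

theorem tensorForm_eq_sum (M : Matrix (Fin m → MultiIndex n) (Fin m → MultiIndex n) ℂ)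
    (z : MultiIndex n → ℂ) : tensorForm M z =
      ∑ A, ∑ B, M A B * ((∏ j, star (z (A j))) * ∏ j, z (B j)) := by
  simp only [tensorForm, tensorPow, dotProduct, Matrix.mulVec, Finset.mul_sum, Pi.star_apply,
    star_prod]
  refine Finset.sum_congr rfl fun A _ => Finset.sum_congr rfl fun B _ => ?_
  ring

theorem kronPow_indexPerm (g : ∀ k, Matrix (Fin (n k)) (Fin (n k)) ℂ)
    (h : Fin r → Equiv.Perm (Fin m)) (A C : Fin m → MultiIndex n) :
    kronPow m g (indexPerm n m h A) (indexPerm n m h C) = kronPow m g A C := by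
  simp only [kronPow, Matrix.of_apply, indexPerm_apply]
  rw [Finset.prod_comm, Finset.prod_comm (f := fun j k => g k (A j k) (C j k))]
  exact Finset.prod_congr rfl fun k _ =>
    Equiv.prod_comp (h k)⁻¹ fun j => g k (A j k) (C j k)

theorem kronPow_mul_permOperator (g : ∀ k, Matrix (Fin (n k)) (Fin (n k)) ℂ)
    (h : Fin r → Equiv.Perm (Fin m)) :
    kronPow m g * permOperator (indexPerm n m h) =
      permOperator (indexPerm n m h) * kronPow m g := by
  ext A C
  rw [permOperator_mul_apply, mul_permOperator_apply,
    ← kronPow_indexPerm g h ((indexPerm n m h)⁻¹ A) C, Equiv.Perm.inv_def, Equiv.apply_symm_apply]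

/-- The part of the first fundamental theorem that is immediate: permutations of the tensor factors
of each kind give invariant functions. -/
theorem tensorForm_permOperator_mulVec (u : UnitaryProduct n) (h : Fin r → Equiv.Perm (Fin m))
    (z : MultiIndex n → ℂ) :
    tensorForm (permOperator (indexPerm n m h))
        ((kronMatrix fun k => (u k : Matrix (Fin (n k)) (Fin (n k)) ℂ)).mulVec z) =
      tensorForm (permOperator (indexPerm n m h)) z := by
  rw [tensorForm_mulVec, mul_assoc, ← kronPow_mul_permOperator, ← mul_assoc,
    kronPow_conjTranspose_mul_self, one_mul]

/-! ### Symmetric coefficient matrices -/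

/-- Two sequences of length `m` in which every value occurs equally often differ by a permutation. -/
theorem exists_perm_of_count_eq {α : Type*} [DecidableEq α] (A B : Fin m → α)
    (h : ∀ a, (∑ j, if A j = a then 1 else 0) = ∑ j, if B j = a then 1 else 0) :
    ∃ σ : Equiv.Perm (Fin m), ∀ j, B (σ j) = A j := by
  have hcard : ∀ a, Fintype.card {j // A j = a} = Fintype.card {j // B j = a} := by
    intro a
    rw [Fintype.card_subtype, Fintype.card_subtype, Finset.card_filter, Finset.card_filter, h a]
  exact ⟨Equiv.ofFiberEquiv fun a => Fintype.equivOfCardEq (hcard a),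
    fun j => Equiv.ofFiberEquiv_map _ j⟩

/-- A function on a family of monomials whose values depend only on the monomials extends to a
linear functional on polynomials. -/
theorem exists_functional_monomial {σ X : Type*} (d : X → σ →₀ ℕ) (ν : X → ℂ)
    (h : ∀ x y, d x = d y → ν x = ν y) :
    ∃ L : MvPolynomial σ ℂ →ₗ[ℂ] ℂ, ∀ x, L (MvPolynomial.monomial (d x) 1) = ν x := by
  obtain ⟨e, he⟩ := (Function.factorsThrough_iff ν).mp fun x y hxy => h x y hxy
  refine ⟨(MvPolynomial.basisMonomials σ ℂ).constr ℂ e, fun x => ?_⟩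
  rw [he]
  exact (MvPolynomial.basisMonomials σ ℂ).constr_basis ℂ e (d x)

theorem sheetOperator_mul_apply (σ : Equiv.Perm (Fin m))
    (M : Matrix (Fin m → MultiIndex n) (Fin m → MultiIndex n) ℂ) (A B : Fin m → MultiIndex n) :
    (sheetOperator n σ * M) A B = M (fun j => A (σ j)) B := by
  rw [sheetOperator, permOperator_mul_apply]
  rfl

theorem mul_sheetOperator_apply (σ : Equiv.Perm (Fin m))
    (M : Matrix (Fin m → MultiIndex n) (Fin m → MultiIndex n) ℂ) (A B : Fin m → MultiIndex n) :
    (M * sheetOperator n σ) A B = M A (fun j => B (σ⁻¹ j)) := by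
  rw [sheetOperator, mul_permOperator_apply]
  rfl

open scoped ComplexOrder in
/-- A matrix acting on the symmetric tensors is determined by its values on the tensor powers. -/
theorem eq_zero_of_tensorForm_eq_zero
    {M : Matrix (Fin m → MultiIndex n) (Fin m → MultiIndex n) ℂ}
    (hl : ∀ σ, sheetOperator n σ * M = M) (hr : ∀ σ, M * sheetOperator n σ = M)
    (h : ∀ z, tensorForm M z = 0) : M = 0 := by
  let d : (Fin m → MultiIndex n) × (Fin m → MultiIndex n) → (MultiIndex n ⊕ MultiIndex n →₀ ℕ) :=
    fun x => ∑ j, Finsupp.single (Sum.inl (x.1 j)) 1 + ∑ j, Finsupp.single (Sum.inr (x.2 j)) 1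
  have hd : ∀ x y, d x = d y → star (M x.1 x.2) = star (M y.1 y.2) := by
    rintro ⟨A, B⟩ ⟨A', B'⟩ hxy
    obtain ⟨σ, hσ⟩ := exists_perm_of_count_eq A A' fun a => by
      simpa [d, Finsupp.single_apply] using DFunLike.congr_fun hxy (Sum.inl a)
    obtain ⟨τ, hτ⟩ := exists_perm_of_count_eq B B' fun a => by
      simpa [d, Finsupp.single_apply] using DFunLike.congr_fun hxy (Sum.inr a)
    congr 1
    change M A B = M A' B'
    rw [← congrFun₂ (hl σ) A' B', sheetOperator_mul_apply, ← congrFun₂ (hr τ⁻¹) _ B',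
      mul_sheetOperator_apply]
    simp [hσ, hτ]
  -- the functional taking `∑ M A B • monomial (d (A, B))` to the sum of the `|M A B| ^ 2`
  obtain ⟨L, hL⟩ := exists_functional_monomial d (fun x => star (M x.1 x.2)) hd
  have hmon : ∀ x z, MvPolynomial.eval (Sum.elim (star z) z)
      (MvPolynomial.monomial (d x) (1 : ℂ)) = (∏ j, star (z (x.1 j))) * ∏ j, z (x.2 j) := by
    intro x z
    have : MvPolynomial.monomial (d x) (1 : ℂ) =
        (∏ j, MvPolynomial.X (Sum.inl (x.1 j))) * ∏ j, MvPolynomial.X (Sum.inr (x.2 j)) := by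
      simp only [d, MvPolynomial.X, ← MvPolynomial.monomial_sum_one, MvPolynomial.monomial_mul,
        mul_one]
    rw [this]
    simp
  have hP := eq_zero_of_eval_conj_eq_zero
    (∑ A, ∑ B, M A B • MvPolynomial.monomial (d (A, B)) (1 : ℂ)) fun z => by
      simp only [map_sum, MvPolynomial.smul_eval, hmon, ← tensorForm_eq_sum, h]
  have hL0 := congrArg L hP
  simp only [map_sum, map_smul, hL, map_zero, smul_eq_mul] at hL0
  ext A B
  have hnn : ∀ A B, 0 ≤ M A B * star (M A B) := fun A B => mul_star_self_nonneg _
  rw [Finset.sum_eq_zero_iff_of_nonneg fun A _ => Finset.sum_nonneg fun B _ => hnn A B] at hL0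
  have := (Finset.sum_eq_zero_iff_of_nonneg fun B _ => hnn A B).mp
    (hL0 A (Finset.mem_univ _)) B (Finset.mem_univ _)
  simpa using this

/-- The symmetrizer, the projection onto the symmetric tensors. -/
noncomputable def symmetrizer (n : Fin r → ℕ) (m : ℕ) :
    Matrix (Fin m → MultiIndex n) (Fin m → MultiIndex n) ℂ :=
  (Fintype.card (Equiv.Perm (Fin m)) : ℂ)⁻¹ • ∑ σ : Equiv.Perm (Fin m), sheetOperator n σ

theorem sheetOperator_mul (σ τ : Equiv.Perm (Fin m)) :
    sheetOperator n (σ * τ) = sheetOperator n σ * sheetOperator n τ := by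
  simp only [sheetOperator, ← permOperator_mul, ← map_mul]
  rfl

theorem symmetrizer_mul_sheetOperator (σ : Equiv.Perm (Fin m)) :
    symmetrizer n m * sheetOperator n σ = symmetrizer n m := by
  simp only [symmetrizer, Matrix.smul_mul, Finset.sum_mul, ← sheetOperator_mul]
  congr 1
  exact Equiv.sum_comp (Equiv.mulRight σ) (sheetOperator n)

theorem sheetOperator_mulVec_tensorPow (σ : Equiv.Perm (Fin m)) (z : MultiIndex n → ℂ) :
    (sheetOperator n σ).mulVec (tensorPow m z) = tensorPow m z := by
  funext A
  have : ∀ B, (A = indexPerm n m (fun _ => σ) B) ↔ B = fun j => A (σ j) := by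
    intro B
    rw [← Equiv.symm_apply_eq, eq_comm]
    rfl
  simp only [sheetOperator, permOperator, Matrix.mulVec, dotProduct, this, ite_mul, one_mul,
    zero_mul, Finset.sum_ite_eq', Finset.mem_univ, if_true, tensorPow]
  exact Equiv.prod_comp σ fun j => z (A j)

theorem symmetrizer_mulVec_tensorPow (z : MultiIndex n → ℂ) :
    (symmetrizer n m).mulVec (tensorPow m z) = tensorPow m z := by
  rw [symmetrizer, Matrix.smul_mulVec, Matrix.sum_mulVec]
  simp only [sheetOperator_mulVec_tensorPow, Finset.sum_const, Finset.card_univ,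
    ← Nat.cast_smul_eq_nsmul ℂ, smul_smul]
  rw [inv_mul_cancel₀ (Nat.cast_ne_zero.mpr Fintype.card_ne_zero), one_smul]

theorem tensorForm_symmetrize (M : Matrix (Fin m → MultiIndex n) (Fin m → MultiIndex n) ℂ)
    (z : MultiIndex n → ℂ) :
    tensorForm ((symmetrizer n m).conjTranspose * M * symmetrizer n m) z = tensorForm M z := by
  simp only [tensorForm, ← Matrix.mulVec_mulVec, symmetrizer_mulVec_tensorPow]
  rw [Matrix.dotProduct_mulVec, ← Matrix.star_mulVec, symmetrizer_mulVec_tensorPow]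

theorem sheetOperator_conjTranspose (σ : Equiv.Perm (Fin m)) :
    (sheetOperator n σ).conjTranspose = sheetOperator n σ⁻¹ := by
  ext A B
  have : B = indexPerm n m (fun _ => σ) A ↔ A = indexPerm n m (fun _ => σ⁻¹) B := by
    rw [← Equiv.symm_apply_eq, eq_comm]
    rfl
  simp only [Matrix.conjTranspose_apply, sheetOperator, permOperator, this, apply_ite star,
    star_one, star_zero]

/-! ### Commutation with the unitary groups -/

/-- A matrix that commutes with the tensor powers of all `u_1 ⊗ ⋯ ⊗ u_r` with `u_k` unitary
commutes with every matrix invariant under `S_m^r`. By Zariski density it commutes with the tensor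
power of the generic matrices, and the entries of the latter are monomials which determine the
orbits of `S_m^r`. -/
theorem commute_of_commute_kronPow {M N : Matrix (Fin m → MultiIndex n) (Fin m → MultiIndex n) ℂ}
    (hM : ∀ u : UnitaryProduct n,
      M * (kronPow m fun k => (u k : Matrix (Fin (n k)) (Fin (n k)) ℂ)) =
        (kronPow m fun k => (u k : Matrix (Fin (n k)) (Fin (n k)) ℂ)) * M)
    (hN : ∀ h A B, N (indexPerm n m h A) (indexPerm n m h B) = N A B) : M * N = N * M := by
  let d : (Fin m → MultiIndex n) × (Fin m → MultiIndex n) →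
      ((Σ k, Fin (n k) × Fin (n k)) →₀ ℕ) :=
    fun x => ∑ k, ∑ j, Finsupp.single ⟨k, x.1 j k, x.2 j k⟩ 1
  have hd : ∀ x y, d x = d y → N x.1 x.2 = N y.1 y.2 := by
    rintro ⟨A, B⟩ ⟨A', B'⟩ hxy
    have : ∀ k, ∃ σ : Equiv.Perm (Fin m), ∀ j, (A' (σ j) k, B' (σ j) k) = (A j k, B j k) := by
      intro k
      refine exists_perm_of_count_eq (fun j => (A j k, B j k)) (fun j => (A' j k, B' j k))
        fun a => ?_
      have hcount : ∀ A B : Fin m → MultiIndex n,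
          d (A, B) ⟨k, a⟩ = ∑ j, if (A j k, B j k) = a then 1 else 0 := by
        intro A B
        simp only [d, Finsupp.coe_finsetSum, Finset.sum_apply]
        rw [Finset.sum_eq_single k]
        · simp [Finsupp.single_apply]
        · intro k' _ hk'
          refine Finset.sum_eq_zero fun j _ => Finsupp.single_eq_of_ne ?_
          intro h
          exact hk' (congrArg Sigma.fst h).symm
        · simp
      rw [← hcount, ← hcount, hxy]
    choose σ hσ using this
    change N A B = N A' B'
    rw [← hN (fun k => (σ k)⁻¹) A' B']
    simp only [indexPerm_apply, inv_inv]
    congr 1 <;> funext j k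
    · exact (congrArg Prod.fst (hσ k j)).symm
    · exact (congrArg Prod.snd (hσ k j)).symm
  -- the functional taking the generic tensor power, entry by entry, to `N`
  obtain ⟨L, hL⟩ := exists_functional_monomial d (fun x => N x.1 x.2) hd
  have hmon : ∀ A B (g : ∀ k, Matrix (Fin (n k)) (Fin (n k)) ℂ),
      MvPolynomial.eval (matrixEntries g) (MvPolynomial.monomial (d (A, B)) (1 : ℂ)) =
        kronPow m g A B := by
    intro A B g
    have : MvPolynomial.monomial (d (A, B)) (1 : ℂ) =
        ∏ k, ∏ j, MvPolynomial.X (⟨k, A j k, B j k⟩ : Σ k, Fin (n k) × Fin (n k)) := by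
      simp only [d, MvPolynomial.X, ← MvPolynomial.monomial_sum_one]
    rw [this]
    simp only [map_prod, MvPolynomial.eval_X, matrixEntries, kronPow, Matrix.of_apply]
    rw [Finset.prod_comm]
  ext A C
  have hP := eq_zero_of_eval_unitary_eq_zero
    (∑ B, M A B • MvPolynomial.monomial (d (B, C)) (1 : ℂ) -
      ∑ B, M B C • MvPolynomial.monomial (d (A, B)) (1 : ℂ)) fun u => by
      have := congrFun₂ (hM u) A C
      simp only [Matrix.mul_apply] at this
      simp only [map_sub, map_sum, MvPolynomial.smul_eval, hmon, this, mul_comm, sub_self]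
  have hL0 := congrArg L hP
  simp only [map_sub, map_sum, map_smul, hL, map_zero, smul_eq_mul] at hL0
  simp only [Matrix.mul_apply]
  rw [sub_eq_zero.mp hL0]
  simp only [mul_comm]

/-- The first fundamental theorem for coefficient matrices: an invariant function
`z ↦ ⟨z^{⊗m}, M z^{⊗m}⟩` is given by a linear combination of permutations in `S_m^r`. -/
theorem exists_mem_span_permOperator
    (M : Matrix (Fin m → MultiIndex n) (Fin m → MultiIndex n) ℂ)
    (h : ∀ (u : UnitaryProduct n) z, tensorForm M
      ((kronMatrix fun k => (u k : Matrix (Fin (n k)) (Fin (n k)) ℂ)).mulVec z) =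
        tensorForm M z) :
    ∃ M' ∈ Submodule.span ℂ (Set.range fun h => permOperator (indexPerm n m h)),
      ∀ z, tensorForm M' z = tensorForm M z := by
  let M' := (symmetrizer n m).conjTranspose * M * symmetrizer n m
  have hM' : ∀ z, tensorForm M' z = tensorForm M z := tensorForm_symmetrize M
  refine ⟨M', mem_span_permOperator _ _ fun N hN => commute_of_commute_kronPow (fun u => ?_) hN,
    hM'⟩
  have hl : ∀ σ, sheetOperator n σ * M' = M' := by
    intro σ
    have : sheetOperator n σ * (symmetrizer n m).conjTranspose =
        (symmetrizer n m).conjTranspose := by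
      rw [← inv_inv σ, ← sheetOperator_conjTranspose, ← Matrix.conjTranspose_mul,
        symmetrizer_mul_sheetOperator]
    simp only [M', ← mul_assoc, this]
  have hr : ∀ σ, M' * sheetOperator n σ = M' := by
    intro σ
    simp only [M', mul_assoc, symmetrizer_mul_sheetOperator]
  set g := kronPow m fun k => (u k : Matrix (Fin (n k)) (Fin (n k)) ℂ) with hg
  have hgg : g.conjTranspose * g = 1 := kronPow_conjTranspose_mul_self u
  have hcomm : ∀ σ, g * sheetOperator n σ = sheetOperator n σ * g := fun σ =>
    kronPow_mul_permOperator _ _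
  have hcomm' : ∀ σ, g.conjTranspose * sheetOperator n σ =
      sheetOperator n σ * g.conjTranspose := by
    intro σ
    rw [hg, kronPow_conjTranspose]
    exact kronPow_mul_permOperator _ _
  have h0 : g.conjTranspose * M' * g - M' = 0 := by
    refine eq_zero_of_tensorForm_eq_zero (fun σ => ?_) (fun σ => ?_) fun z => ?_
    · rw [mul_sub, hl, ← mul_assoc, ← mul_assoc, ← hcomm', mul_assoc _ _ M', hl]
    · rw [sub_mul, hr, mul_assoc, hcomm, ← mul_assoc, mul_assoc _ M', hr]
    · have : tensorForm (g.conjTranspose * M' * g - M') z =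
          tensorForm (g.conjTranspose * M' * g) z - tensorForm M' z := by
        simp only [tensorForm, Matrix.sub_mulVec, dotProduct_sub]
      rw [this, ← tensorForm_mulVec, hM', hM', h, sub_self]
  rw [sub_eq_zero] at h0
  calc M' * g = g * g.conjTranspose * (M' * g) := by rw [mul_eq_one_comm.mp hgg, one_mul]
    _ = g * (g.conjTranspose * M' * g) := by simp only [mul_assoc]
    _ = g * M' := by rw [h0]

end TensorPowers

/-! ### Polynomial functions in terms of the coordinates -/

section Coordinates

variable {r m : ℕ} {n : Fin r → ℕ}

/-- The coordinates `y` and `x`, as one family of functions. -/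
noncomputable def coordFamily (n : Fin r → ℕ) : MultiIndex n ⊕ MultiIndex n → TensorSpace n → ℂ :=
  Sum.elim (yCoord n) (xCoord n)

theorem xCoord_smul (i : MultiIndex n) (c : ℂ) (v : TensorSpace n) :
    xCoord n i (c • v) = c * xCoord n i v := by
  simp [xCoord]

theorem exists_xCoord_eq (z : MultiIndex n → ℂ) :
    ∃ v : TensorSpace n, (fun i => xCoord n i v) = z := by
  refine ⟨(Basis.piTensorProduct fun k => Pi.basisFun ℂ (Fin (n k))).equivFun.symm z, ?_⟩
  exact (Basis.piTensorProduct fun k => Pi.basisFun ℂ (Fin (n k))).equivFun.apply_symm_apply z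

theorem xCoord_tensorRep (u : UnitaryProduct n) (v : TensorSpace n) :
    (fun i => xCoord n i (tensorRep n u v)) =
      (kronMatrix fun k => (u k : Matrix (Fin (n k)) (Fin (n k)) ℂ)).mulVec
        fun i => xCoord n i v := by
  -- both sides are linear in `v`, so pure tensors suffice
  let b := Basis.piTensorProduct fun k => Pi.basisFun ℂ (Fin (n k))
  have h : b.equivFun.toLinearMap ∘ₗ tensorRep n u =
      (kronMatrix fun k => (u k : Matrix (Fin (n k)) (Fin (n k)) ℂ)).mulVecLin ∘ₗ
        b.equivFun.toLinearMap := by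
    refine PiTensorProduct.ext (MultilinearMap.ext fun w => ?_)
    funext i
    have hb : ∀ w i, b.equivFun (PiTensorProduct.tprod ℂ w) i = ∏ k, w k (i k) := by
      intro w i
      simp [b, Basis.piTensorProduct_repr_tprod_apply]
    have hu : tensorRep n u (PiTensorProduct.tprod ℂ w) = PiTensorProduct.tprod ℂ fun k =>
        Matrix.toLin' (u k : Matrix (Fin (n k)) (Fin (n k)) ℂ) (w k) :=
      PiTensorProduct.map_tprod _ _
    simp only [LinearMap.compMultilinearMap_apply, LinearMap.comp_apply, hu,
      LinearEquiv.coe_coe, hb, Matrix.mulVecLin_apply, Matrix.mulVec, dotProduct, kronMatrix,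
      Matrix.of_apply, ← Finset.prod_mul_distrib, Matrix.toLin'_apply, Fintype.prod_sum]
  exact LinearMap.congr_fun h v

theorem exists_eq_sum_repr_conj_add {V ι : Type*} [AddCommGroup V] [Module ℂ V] [Fintype ι]
    (b : Module.Basis ι ℂ V) (l : V →ₗ[ℝ] ℂ) : ∃ a : ι ⊕ ι → ℂ, ∀ v, l v =
      ∑ i, (a (Sum.inl i) * starRingEnd ℂ (b.repr v i) + a (Sum.inr i) * b.repr v i) := by
  refine ⟨Sum.elim (fun i => (l (b i) + Complex.I * l (Complex.I • b i)) / 2)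
    fun i => (l (b i) - Complex.I * l (Complex.I • b i)) / 2, fun v => ?_⟩
  have hsmul : ∀ (c : ℂ) (e : V), l (c • e) = c.re * l e + c.im * l (Complex.I • e) := by
    intro c e
    have hc : c • e = c.re • e + c.im • (Complex.I • e) := by
      rw [← Complex.coe_smul c.re, ← Complex.coe_smul c.im, smul_smul, ← add_smul,
        Complex.re_add_im]
    rw [hc, map_add, map_smul, map_smul, Complex.real_smul, Complex.real_smul]
  conv_lhs => rw [← b.sum_repr v]
  rw [map_sum]
  refine Finset.sum_congr rfl fun i _ => ?_
  rw [hsmul]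
  simp only [Sum.elim_inl, Sum.elim_inr]
  generalize b.repr v i = c
  have h1 : (starRingEnd ℂ) c = c.re - c.im * Complex.I := by
    apply Complex.ext <;> simp
  have h2 := (Complex.re_add_im c).symm
  linear_combination (-(l (b i) + Complex.I * l (Complex.I • b i)) / 2) * h1 -
    ((l (b i) - Complex.I * l (Complex.I • b i)) / 2) * h2 +
    (c.im * l (Complex.I • b i)) * Complex.I_sq

theorem exists_realLinear_eq_repr {V ι : Type*} [AddCommGroup V] [Module ℂ V]
    (b : Module.Basis ι ℂ V) (i : ι ⊕ ι) : ∃ l : V →ₗ[ℝ] ℂ,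
      ∀ v, l v = Sum.elim (fun i => starRingEnd ℂ (b.repr v i)) (fun i => b.repr v i) i := by
  rcases i with i | i
  · exact ⟨Complex.conjAe.toLinearMap ∘ₗ (b.coord i).restrictScalars ℝ, fun _ => rfl⟩
  · exact ⟨(b.coord i).restrictScalars ℝ, fun _ => rfl⟩

theorem realPoly_eq_span_coordFamily (d : ℕ) :
    realPoly (TensorSpace n) d = Submodule.span ℂ (Set.range
      fun (t : Fin d → MultiIndex n ⊕ MultiIndex n) (v : TensorSpace n) =>
        ∏ i, coordFamily n (t i) v) := by
  let b := Basis.piTensorProduct fun k => Pi.basisFun ℂ (Fin (n k))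
  apply le_antisymm
  · refine Submodule.span_le.mpr ?_
    rintro _ ⟨l, rfl⟩
    choose a ha using fun i => exists_eq_sum_repr_conj_add b (l i)
    have ha' : ∀ i v, l i v = ∑ w, a i w * coordFamily n w v := fun i v => by
      rw [ha, Finset.sum_add_distrib, Fintype.sum_sum_type]
      rfl
    have : (fun v => ∏ i, l i v) = ∑ t : Fin d → MultiIndex n ⊕ MultiIndex n,
        (∏ i, a i (t i)) • fun v : TensorSpace n => ∏ i, coordFamily n (t i) v := by
      funext v
      simp only [ha', Fintype.prod_sum, Finset.prod_mul_distrib, Finset.sum_apply, Pi.smul_apply,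
        smul_eq_mul]
    simp only [this]
    exact Submodule.sum_mem _ fun t _ => Submodule.smul_mem _ _ (Submodule.subset_span ⟨t, rfl⟩)
  · refine Submodule.span_le.mpr ?_
    rintro _ ⟨t, rfl⟩
    choose l hl using fun i => exists_realLinear_eq_repr b (t i)
    refine Submodule.subset_span ⟨l, funext fun v => Finset.prod_congr rfl fun i _ => ?_⟩
    rw [hl]
    cases t i <;> rfl

/-- The functions `v ↦ ⟨v^{⊗m}, M v^{⊗m}⟩`, that is, the polynomial functions of degree `m` in the
coordinates `x` and of degree `m` in the coordinates `y`. -/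
noncomputable def tensorFormMap (n : Fin r → ℕ) (m : ℕ) :
    Matrix (Fin m → MultiIndex n) (Fin m → MultiIndex n) ℂ →ₗ[ℂ] TensorSpace n → ℂ where
  toFun M v := tensorForm M fun i => xCoord n i v
  map_add' M M' := by
    funext v
    simp only [tensorForm, Matrix.add_mulVec, dotProduct_add, Pi.add_apply]
  map_smul' c M := by
    funext v
    simp only [tensorForm, Matrix.smul_mulVec, dotProduct_smul, Pi.smul_apply, RingHom.id_apply]

theorem tensorFormMap_eq_sum (M : Matrix (Fin m → MultiIndex n) (Fin m → MultiIndex n) ℂ)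
    (v : TensorSpace n) : tensorFormMap n m M v =
      ∑ A, ∑ B, M A B * ((∏ j, yCoord n (A j) v) * ∏ j, xCoord n (B j) v) :=
  tensorForm_eq_sum _ _

theorem tensorFormMap_mem_realPoly
    (M : Matrix (Fin m → MultiIndex n) (Fin m → MultiIndex n) ℂ) :
    tensorFormMap n m M ∈ realPoly (TensorSpace n) (2 * m) := by
  have h : tensorFormMap n m M = ∑ A, ∑ B, M A B • fun v : TensorSpace n =>
      (∏ j, yCoord n (A j) v) * ∏ j, xCoord n (B j) v := by
    funext v
    simp only [tensorFormMap_eq_sum, Finset.sum_apply, Pi.smul_apply, smul_eq_mul]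
  rw [h, realPoly_eq_span_coordFamily]
  refine Submodule.sum_mem _ fun A _ => Submodule.sum_mem _ fun B _ =>
    Submodule.smul_mem _ _ (Submodule.subset_span ?_)
  let e : Fin (2 * m) ≃ Fin m ⊕ Fin m := (finCongr (two_mul m)).trans finSumFinEquiv.symm
  refine ⟨fun i => Sum.map A B (e i), funext fun v => ?_⟩
  change ∏ i, coordFamily n (Sum.map A B (e i)) v = _
  rw [Equiv.prod_comp e fun i => coordFamily n (Sum.map A B i) v, Fintype.prod_sum_type]
  rfl

/-- A product of coordinates with `m` factors of each kind is `⟨v^{⊗m}, M v^{⊗m}⟩` for a matrix unit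
`M`. -/
theorem prod_coordFamily_mem_range (t : Fin (2 * m) → MultiIndex n ⊕ MultiIndex n)
    (ht : Fintype.card {i // (t i).isLeft} = m) :
    (fun v : TensorSpace n => ∏ i, coordFamily n (t i) v) ∈
      LinearMap.range (tensorFormMap n m) := by
  have ht' : Fintype.card {i // ¬ (t i).isLeft} = m := by
    rw [Fintype.card_subtype_compl, ht, Fintype.card_fin]
    omega
  let e₁ := (Fintype.equivFinOfCardEq ht).symm
  let e₂ := (Fintype.equivFinOfCardEq ht').symm
  have h₁ : ∀ j, ∃ a, t (e₁ j) = Sum.inl a := fun j => Sum.isLeft_iff.mp (e₁ j).2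
  have h₂ : ∀ j, ∃ a, t (e₂ j) = Sum.inr a := fun j => by
    have := (e₂ j).2
    rw [Sum.not_isLeft] at this
    exact Sum.isRight_iff.mp this
  choose A hA using h₁
  choose B hB using h₂
  refine ⟨Matrix.single A B 1, funext fun v => ?_⟩
  have hprod : ∏ i, coordFamily n (t i) v =
      (∏ j, yCoord n (A j) v) * ∏ j, xCoord n (B j) v := by
    rw [← Fintype.prod_subtype_mul_prod_subtype (fun i => (t i).isLeft = true),
      ← Equiv.prod_comp e₁, ← Equiv.prod_comp e₂]
    simp only [hA, hB]
    rfl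
  rw [hprod, tensorFormMap_eq_sum, Finset.sum_eq_single A, Finset.sum_eq_single B]
  · simp
  · intro B' _ hB'
    simp [hB'.symm]
  · simp
  · intro A' _ hA'
    simp [hA'.symm]
  · simp

theorem prod_coordFamily_smul {d : ℕ} (t : Fin d → MultiIndex n ⊕ MultiIndex n) (c : ℂ)
    (v : TensorSpace n) : ∏ i, coordFamily n (t i) (c • v) =
      starRingEnd ℂ c ^ Fintype.card {i // (t i).isLeft} *
        c ^ Fintype.card {i // ¬ (t i).isLeft} * ∏ i, coordFamily n (t i) v := by
  have h : ∀ w, coordFamily n w (c • v) =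
      (if w.isLeft then starRingEnd ℂ c else c) * coordFamily n w v := by
    rintro (i | i) <;> simp [coordFamily, yCoord, xCoord_smul]
  simp only [h, Finset.prod_mul_distrib, Finset.prod_ite, Finset.prod_const,
    Fintype.card_subtype]

/-- A polynomial function of degree `2 * m` that is invariant under multiplication by complex
numbers of modulus one has the same degree in `x` and `y`: average it over the roots of unity of
order `2 * m + 1`. -/
theorem mem_range_tensorFormMap {f : TensorSpace n → ℂ}
    (hf : f ∈ realPoly (TensorSpace n) (2 * m))
    (hinv : ∀ c : ℂ, starRingEnd ℂ c * c = 1 → ∀ v, f (c • v) = f v) :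
    f ∈ LinearMap.range (tensorFormMap n m) := by
  obtain ⟨ζ, hζ⟩ : ∃ ζ : ℂ, IsPrimitiveRoot ζ (2 * m + 1) :=
    ⟨_, Complex.isPrimitiveRoot_exp (2 * m + 1) (by omega)⟩
  have hconj : starRingEnd ℂ ζ * ζ = 1 := by
    rw [mul_comm, Complex.mul_conj, Complex.normSq_eq_norm_sq,
      hζ.norm'_eq_one (by omega)]
    simp
  let T : (TensorSpace n → ℂ) →ₗ[ℂ] (TensorSpace n → ℂ) :=
    ((2 * m + 1 : ℕ) : ℂ)⁻¹ • ∑ i ∈ Finset.range (2 * m + 1),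
      LinearMap.funLeft ℂ ℂ fun v : TensorSpace n => ζ ^ i • v
  -- `T` fixes `f`, and it fixes or kills each product of coordinates
  have hT : ∀ g v, T g v = ((2 * m + 1 : ℕ) : ℂ)⁻¹ *
      ∑ i ∈ Finset.range (2 * m + 1), g (ζ ^ i • v) := by
    intro g v
    simp only [T, LinearMap.smul_apply, LinearMap.sum_apply, Pi.smul_apply, Finset.sum_apply,
      LinearMap.funLeft_apply, smul_eq_mul]
  have hN : ((2 * m + 1 : ℕ) : ℂ) ≠ 0 := Nat.cast_ne_zero.mpr (by omega)
  have hTf : T f = f := by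
    funext v
    have hpow : ∀ i : ℕ, f (ζ ^ i • v) = f v := fun i => hinv _ (by
      rw [map_pow, ← mul_pow, hconj, one_pow]) v
    rw [hT]
    simp only [hpow, Finset.sum_const, Finset.card_range, nsmul_eq_mul]
    rw [inv_mul_cancel_left₀ hN]
  rw [← hTf]
  rw [realPoly_eq_span_coordFamily] at hf
  clear hTf hinv
  induction hf using Submodule.span_induction with
  | zero => rw [map_zero]; exact zero_mem _
  | add f g _ _ hf hg => rw [map_add]; exact add_mem hf hg
  | smul c f _ hf => rw [map_smul]; exact Submodule.smul_mem _ c hf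
  | mem f hf =>
    obtain ⟨t, rfl⟩ := hf
    set p := Fintype.card {i // (t i).isLeft} with hp
    set q := Fintype.card {i // ¬ (t i).isLeft} with hq
    have hpq : p + q = 2 * m := by
      have h1 := Fintype.card_subtype_compl fun i => (t i).isLeft = true
      have h2 := Fintype.card_subtype_le fun i => (t i).isLeft = true
      rw [Fintype.card_fin] at h1 h2
      omega
    let η := starRingEnd ℂ ζ ^ p * ζ ^ q
    have hη : ∀ (i : ℕ) (v : TensorSpace n), ∏ k, coordFamily n (t k) (ζ ^ i • v) =
        η ^ i * ∏ k, coordFamily n (t k) v := by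
      intro i v
      rw [prod_coordFamily_smul, map_pow]
      simp only [← hp, ← hq, η]
      ring
    by_cases h1 : η = 1
    · have hpow : ζ ^ p = ζ ^ q := by
        calc ζ ^ p = ζ ^ p * η := by rw [h1, mul_one]
          _ = (starRingEnd ℂ ζ * ζ) ^ p * ζ ^ q := by simp only [η]; ring
          _ = ζ ^ q := by rw [hconj, one_pow, one_mul]
      have : p = q := hζ.pow_inj (by omega) (by omega) hpow
      have hmem := prod_coordFamily_mem_range (m := m) t (by omega)
      convert hmem using 1
      funext v
      rw [hT]
      simp only [hη, h1, one_pow, one_mul, Finset.sum_const, Finset.card_range, nsmul_eq_mul]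
      rw [inv_mul_cancel_left₀ hN]
    · have hsum : ∑ i ∈ Finset.range (2 * m + 1), η ^ i = 0 := by
        have h2 := geom_sum_mul η (2 * m + 1)
        have h3 : η ^ (2 * m + 1) = 1 := by
          have h4 : starRingEnd ℂ ζ ^ (2 * m + 1) = 1 := by
            rw [← map_pow, hζ.pow_eq_one, map_one]
          simp only [η]
          rw [mul_pow, ← pow_mul, ← pow_mul, mul_comm p, mul_comm q, pow_mul, pow_mul, h4,
            hζ.pow_eq_one, one_pow, one_pow, one_mul]
        rw [h3, sub_self] at h2
        exact (mul_eq_zero.mp h2).resolve_right (sub_ne_zero.mpr h1)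
      convert zero_mem (LinearMap.range (tensorFormMap n m)) using 1
      funext v
      rw [hT]
      simp only [hη, ← Finset.sum_mul, hsum, zero_mul, mul_zero, Pi.zero_apply]

end Coordinates

/-! ### The invariants of the product of unitary groups -/

section Invariants

variable {s m : ℕ} {n : Fin (s + 1) → ℕ}

theorem tensorFormMap_permOperator (h : Fin (s + 1) → Equiv.Perm (Fin m)) (v : TensorSpace n) :
    tensorFormMap n m (permOperator (indexPerm n m h)) v =
      ∑ I : Fin m → MultiIndex n, (∏ j, xCoord n (I j) v) *
        ∏ j, yCoord n (fun k => I ((h k)⁻¹ j) k) v := by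
  rw [tensorFormMap_eq_sum, Finset.sum_comm]
  simp only [permOperator, ite_mul, one_mul, zero_mul, Finset.sum_ite_eq',
    Finset.mem_univ, if_true]
  exact Finset.sum_congr rfl fun I _ => mul_comm _ _

theorem permInvariant_eq_tensorFormMap (σ : Fin s → Equiv.Perm (Fin m)) :
    permInvariant n σ =
      tensorFormMap n m (permOperator (indexPerm n m fun k => (extendOne σ k)⁻¹)) := by
  funext v
  rw [tensorFormMap_permOperator]
  simp only [inv_inv]
  rfl

/-- The last of `s + 1` permutations is normalized to `1` by reindexing the `m` tensor factors. -/
theorem exists_permInvariant_eq_tensorFormMap (h : Fin (s + 1) → Equiv.Perm (Fin m)) :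
    ∃ σ : Fin s → Equiv.Perm (Fin m),
      permInvariant n σ = tensorFormMap n m (permOperator (indexPerm n m h)) := by
  refine ⟨fun k => (h k.castSucc)⁻¹ * h (Fin.last s), funext fun v => ?_⟩
  rw [tensorFormMap_permOperator, permInvariant]
  refine Finset.sum_congr rfl fun I _ => ?_
  rw [← Equiv.prod_comp (h (Fin.last s)) fun j => yCoord n (fun k => I ((h k)⁻¹ j) k) v]
  congr 1
  refine Finset.prod_congr rfl fun j _ => ?_
  congr 1
  funext k
  have : extendOne (fun k : Fin s => (h k.castSucc)⁻¹ * h (Fin.last s)) k =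
      (h k)⁻¹ * h (Fin.last s) := by
    refine Fin.lastCases ?_ (fun k => ?_) k <;> simp [extendOne]
  rw [this, Equiv.Perm.mul_apply]

/-- The scalars of modulus one occur in the action of the first unitary group. -/
theorem exists_tensorRep_eq_smul (n : Fin (s + 1) → ℕ) {c : ℂ} (hc : starRingEnd ℂ c * c = 1) :
    ∃ u : UnitaryProduct n, ∀ v, tensorRep n u v = c • v := by
  have hu : ∀ k, c • (1 : Matrix (Fin (n k)) (Fin (n k)) ℂ) ∈
      Matrix.unitaryGroup (Fin (n k)) ℂ := by
    intro k
    rw [Matrix.mem_unitaryGroup_iff', star_smul, star_one, smul_mul_smul_comm, one_mul]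
    change (starRingEnd ℂ c * c) • _ = _
    rw [hc, one_smul]
  refine ⟨Function.update 1 0 ⟨_, hu 0⟩, fun v => ?_⟩
  have : tensorRep n (Function.update 1 0 ⟨_, hu 0⟩) = c • LinearMap.id := by
    refine PiTensorProduct.ext (MultilinearMap.ext fun w => ?_)
    have h1 : ∀ k, Matrix.toLin' ((Function.update (1 : UnitaryProduct n) 0 ⟨_, hu 0⟩ k :
        Matrix.unitaryGroup (Fin (n k)) ℂ) : Matrix (Fin (n k)) (Fin (n k)) ℂ) (w k) =
        Function.update w 0 (c • w 0) k := by
      intro k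
      by_cases hk : k = 0
      · subst hk
        simp
      · simp [Function.update_of_ne hk]
    have h2 : tensorRep n (Function.update 1 0 ⟨_, hu 0⟩) (PiTensorProduct.tprod ℂ w) =
        PiTensorProduct.tprod ℂ (Function.update w 0 (c • w 0)) :=
      (PiTensorProduct.map_tprod _ _).trans (congrArg _ (funext h1))
    simp only [LinearMap.compMultilinearMap_apply, h2, MultilinearMap.map_update_smul,
      Function.update_eq_self, LinearMap.smul_apply, LinearMap.id_apply]
  rw [this, LinearMap.smul_apply, LinearMap.id_apply]

theorem permInvariant_mem_invariantRealPoly (σ : Fin s → Equiv.Perm (Fin m)) :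
    permInvariant n σ ∈ invariantRealPoly (tensorRep n) (2 * m) := by
  rw [permInvariant_eq_tensorFormMap]
  refine ⟨tensorFormMap_mem_realPoly _, fun u v => ?_⟩
  change tensorForm _ (fun i => xCoord n i (tensorRep n u⁻¹ v)) = _
  rw [xCoord_tensorRep, tensorForm_permOperator_mulVec]
  rfl

theorem span_classInvariant (n : Fin (s + 1) → ℕ) (m : ℕ) :
    Submodule.span ℂ (Set.range fun c : PermClass s m => classInvariant n c) =
      invariantRealPoly (tensorRep n) (2 * m) := by
  apply le_antisymm
  · refine Submodule.span_le.mpr ?_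
    rintro _ ⟨⟨σ⟩, rfl⟩
    exact permInvariant_mem_invariantRealPoly σ
  · rintro f ⟨hf, hinv⟩
    have hinv' : ∀ (u : UnitaryProduct n) v, f (tensorRep n u v) = f v := by
      intro u v
      rw [← inv_inv u, hinv]
    obtain ⟨M, rfl⟩ := mem_range_tensorFormMap hf fun c hc v => by
      obtain ⟨u, hu⟩ := exists_tensorRep_eq_smul n hc
      rw [← hu, hinv']
    obtain ⟨M', hM', h⟩ := exists_mem_span_permOperator M fun u z => by
      obtain ⟨v, rfl⟩ := exists_xCoord_eq z
      rw [← xCoord_tensorRep]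
      exact hinv' u v
    have hMM' : tensorFormMap n m M = tensorFormMap n m M' := funext fun v => (h _).symm
    rw [hMM']
    have := Submodule.mem_map_of_mem (f := tensorFormMap n m) hM'
    rw [Submodule.map_span] at this
    refine Submodule.span_mono ?_ this
    rintro _ ⟨_, ⟨h, rfl⟩, rfl⟩
    obtain ⟨σ, hσ⟩ := exists_permInvariant_eq_tensorFormMap (n := n) h
    exact ⟨Quotient.mk _ σ, hσ⟩

end Invariants

/-! ### Coverings of a graph given by voltages -/

section Coverings

open SimpleGraph

universe u

variable {V : Type u} {G : SimpleGraph V} {m : ℕ}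

/-- The covering of `G` with vertex set `V × Fin m` defined by a voltage assignment `α`: the sheet
`i` over `v` is joined to the sheet `α v w i` over each neighbor `w` of `v`. -/
def voltageCovering (G : SimpleGraph V) (hm : 0 < m) (α : V → V → Equiv.Perm (Fin m))
    (hα : ∀ v w, α w v = (α v w)⁻¹) : GraphCovering G m where
  vertices := V × Fin m
  graph :=
    { Adj := fun x y => G.Adj x.1 y.1 ∧ y.2 = α x.1 y.1 x.2
      symm := ⟨by
        rintro x y ⟨h, h'⟩
        exact ⟨h.symm, by rw [hα x.1 y.1, h']; simp⟩⟩
      loopless := ⟨fun x h => G.irrefl h.1⟩ }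
  proj := Prod.fst
  surjective := fun v => ⟨(v, ⟨0, hm⟩), rfl⟩
  bijOn := by
    rintro ⟨v, i⟩
    refine ⟨fun y hy => hy.1, ?_, fun w hw => ⟨(w, α v w i), ⟨hw, rfl⟩, rfl⟩⟩
    rintro ⟨w, j⟩ ⟨_, hj⟩ ⟨w', j'⟩ ⟨_, hj'⟩ (rfl : w = w')
    exact Prod.ext rfl (hj.trans hj'.symm)
  fold := by
    intro v
    have h : (Prod.fst ⁻¹' {v} : Set (V × Fin m)) = Set.range fun i : Fin m => (v, i) := by
      ext ⟨w, i⟩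
      simp [eq_comm]
    rw [h, ← Set.image_univ, Function.Injective.encard_image (Prod.mk_right_injective v)]
    simp

theorem voltageCovering_iso {hm : 0 < m} {α α' : V → V → Equiv.Perm (Fin m)}
    {hα : ∀ v w, α w v = (α v w)⁻¹} {hα' : ∀ v w, α' w v = (α' v w)⁻¹}
    (τ : V → Equiv.Perm (Fin m))
    (h : ∀ v w, G.Adj v w → ∀ i, α' v w (τ v i) = τ w (α v w i)) :
    coveringIso G m (voltageCovering G hm α hα) (voltageCovering G hm α' hα') := by
  refine ⟨⟨Equiv.prodShear (Equiv.refl V) τ, ?_⟩, fun _ => rfl⟩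
  rintro ⟨v, i⟩ ⟨w, j⟩
  change G.Adj v w ∧ τ w j = α' v w (τ v i) ↔ G.Adj v w ∧ j = α v w i
  refine and_congr_right fun hvw => ?_
  rw [h v w hvw, (τ w).injective.eq_iff]

theorem exists_perm_of_voltageCovering_iso {hm : 0 < m} {α α' : V → V → Equiv.Perm (Fin m)}
    {hα : ∀ v w, α w v = (α v w)⁻¹} {hα' : ∀ v w, α' w v = (α' v w)⁻¹}
    (h : coveringIso G m (voltageCovering G hm α hα) (voltageCovering G hm α' hα')) :
    ∃ τ : V → Equiv.Perm (Fin m), ∀ v w, G.Adj v w → ∀ i, α' v w (τ v i) = τ w (α v w i) := by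
  obtain ⟨Φ, hΦ⟩ := h
  change ∀ x : V × Fin m, (Φ x).1 = x.1 at hΦ
  have hinj : ∀ v, Function.Injective fun i : Fin m => (Φ (v, i)).2 := by
    intro v i j hij
    have : Φ (v, i) = Φ (v, j) := Prod.ext ((hΦ (v, i)).trans (hΦ (v, j)).symm) hij
    exact (Prod.ext_iff.mp (Φ.injective this)).2
  refine ⟨fun v => Equiv.ofBijective _ (Finite.injective_iff_bijective.mp (hinj v)), ?_⟩
  intro v w hvw i
  have h1 : (voltageCovering G hm α hα).graph.Adj (v, i) (w, α v w i) := ⟨hvw, rfl⟩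
  have h2 := (Φ.map_adj_iff.mpr h1).2
  rw [hΦ (v, i), hΦ (w, _)] at h2
  exact h2.symm

/-! ### A rooted spanning tree and the remaining edges -/

/-- A shortest path to the root `r` gives every other vertex a parent; the edges from the vertices
to their parents form a spanning tree. -/
theorem exists_parent (hG : G.Connected) (r : V) :
    ∃ par : V → V, ∀ v, v ≠ r → G.Adj v (par v) ∧ G.dist (par v) r < G.dist v r := by
  have : ∀ v, ∃ w, v ≠ r → G.Adj v w ∧ G.dist w r < G.dist v r := by
    intro v
    obtain ⟨p, hp⟩ := hG.exists_walk_length_eq_dist v r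
    cases p with
    | nil => exact ⟨r, fun h => absurd rfl h⟩
    | @cons _ w _ h q =>
      refine ⟨w, fun _ => ⟨h, ?_⟩⟩
      have := G.dist_le q
      rw [Walk.length_cons] at hp
      omega
  choose par hpar using this
  exact ⟨par, hpar⟩

theorem parent_induction {r : V} {par : V → V}
    (hpar : ∀ v, v ≠ r → G.Adj v (par v) ∧ G.dist (par v) r < G.dist v r) {P : V → Prop}
    (hr : P r) (h : ∀ v, v ≠ r → P (par v) → P v) (v : V) : P v := by
  induction hd : G.dist v r using Nat.strong_induction_on generalizing v with
  | _ d ih =>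
    by_cases hv : v = r
    · exact hv ▸ hr
    · exact h v hv (ih _ (hd ▸ (hpar v hv).2) _ rfl)

/-- Recursion along the tree: `base` is used at the root only, and `step` leads from the parent of a
vertex to the vertex. -/
theorem exists_parent_recursion {r : V} {par : V → V}
    (hpar : ∀ v, v ≠ r → G.Adj v (par v) ∧ G.dist (par v) r < G.dist v r) {F : V → Type*}
    (base : ∀ v, F v) (step : ∀ v w, F v → F w) :
    ∃ ψ : ∀ v, F v, ∀ v, v ≠ r → ψ v = step (par v) v (ψ (par v)) := by
  classical
  let rel : V → V → Prop := InvImage (· < ·) fun v => G.dist v r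
  have hwf : WellFounded rel := InvImage.wf _ wellFounded_lt
  refine ⟨hwf.fix fun v ih =>
    if h : v = r then base v else step (par v) v (ih (par v) (hpar v h).2), fun v hv => ?_⟩
  rw [hwf.fix_eq, dif_neg hv]

/-- The edges outside the spanning tree of parents, counted by the first Betti number, enumerated
and oriented: the `k`-th one leads from `a k` to `b k`. -/
theorem exists_cotree_edges [Finite V] {s : ℕ} (hs : bettiNumber G = s) {r : V} {par : V → V}
    (hpar : ∀ v, v ≠ r → G.Adj v (par v) ∧ G.dist (par v) r < G.dist v r) :
    ∃ a b : Fin s → V, (∀ k, G.Adj (a k) (b k)) ∧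
      (Function.Injective fun k => s(a k, b k)) ∧
      (∀ k v, v ≠ r → s(v, par v) ≠ s(a k, b k)) ∧
      ∀ v w, G.Adj v w → (∃ u, u ≠ r ∧ s(v, w) = s(u, par u)) ∨ ∃ k, s(v, w) = s(a k, b k) := by
  classical
  let T : Set (Sym2 V) := (fun v => s(v, par v)) '' {r}ᶜ
  have hTG : T ⊆ G.edgeSet := by
    rintro _ ⟨v, hv, rfl⟩
    exact (hpar v hv).1
  have hinj : Set.InjOn (fun v => s(v, par v)) {r}ᶜ := by
    intro v hv w hw h
    rcases Sym2.eq_iff.mp h with h | ⟨h, h'⟩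
    · exact h.1
    · have h1 := (hpar v hv).2
      have h2 := (hpar w hw).2
      rw [h'] at h1
      rw [← h] at h2
      omega
  have hTcard : T.ncard + 1 = Nat.card V := by
    rw [Set.InjOn.ncard_image hinj, add_comm, ← Set.ncard_add_ncard_compl {r}, Set.ncard_singleton]
  have hcard : Nat.card ↥(G.edgeSet \ T) = s := by
    have h1 := Set.ncard_sdiff_add_ncard_of_subset hTG
    rw [bettiNumber] at hs
    rw [Nat.card_coe_set_eq] at hs ⊢
    omega
  let e : Fin s ≃ ↥(G.edgeSet \ T) := (finCongr hcard.symm).trans (Finite.equivFin _).symm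
  have hrep : ∀ k, ∃ x : V × V, s(x.1, x.2) = (e k : Sym2 V) := by
    intro k
    induction h : (e k : Sym2 V) using Sym2.ind with
    | _ x y => exact ⟨(x, y), rfl⟩
  choose x hx using hrep
  refine ⟨fun k => (x k).1, fun k => (x k).2, ?_, ?_, ?_, ?_⟩
  · intro k
    rw [← SimpleGraph.mem_edgeSet, hx]
    exact (e k).2.1
  · intro k l h
    simp only [hx] at h
    exact e.injective (Subtype.ext h)
  · intro k v hv h
    rw [hx] at h
    exact (e k).2.2 ⟨v, hv, h⟩
  · intro v w h
    by_cases hT : s(v, w) ∈ T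
    · obtain ⟨u, hu, hvw⟩ := hT
      exact Or.inl ⟨u, hu, hvw.symm⟩
    · refine Or.inr ⟨e.symm ⟨s(v, w), h, hT⟩, ?_⟩
      rw [hx, Equiv.apply_symm_apply]

/-! ### The covering attached to a tuple of permutations -/

variable {s : ℕ}

/-- The two orientations of the edges `s(a k, b k)`. -/
def orientedEdges (a b : Fin s → V) : Fin s ⊕ Fin s → V × V :=
  Sum.elim (fun k => (a k, b k)) fun k => (b k, a k)

/-- The voltage assignment with value `σ k` on the oriented edge from `a k` to `b k`, and trivial
on all edges not of the form `s(a k, b k)`. -/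
noncomputable def tupleVoltage (a b : Fin s → V) (σ : Fin s → Equiv.Perm (Fin m)) (v w : V) :
    Equiv.Perm (Fin m) :=
  Function.extend (orientedEdges a b) (Sum.elim σ fun k => (σ k)⁻¹) 1 (v, w)

variable {a b : Fin s → V}

theorem orientedEdges_injective (hab : ∀ k, a k ≠ b k)
    (hinj : Function.Injective fun k => s(a k, b k)) :
    Function.Injective (orientedEdges a b) := by
  rintro (k | k) (l | l) h <;> simp only [orientedEdges, Sum.elim_inl, Sum.elim_inr,
    Prod.mk.injEq] at h
  · rw [hinj (a₁ := k) (a₂ := l) (by simp [h])]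
  · obtain rfl : k = l := hinj (by simp [h])
    exact absurd h.1 (hab k)
  · obtain rfl : k = l := hinj (by simp [h])
    exact absurd h.2 (hab k)
  · rw [hinj (a₁ := k) (a₂ := l) (by simp [h])]

theorem tupleVoltage_apply (hab : ∀ k, a k ≠ b k)
    (hinj : Function.Injective fun k => s(a k, b k)) (σ : Fin s → Equiv.Perm (Fin m))
    (k : Fin s) : tupleVoltage a b σ (a k) (b k) = σ k :=
  (orientedEdges_injective hab hinj).extend_apply _ _ (Sum.inl k)

theorem tupleVoltage_apply_swap (hab : ∀ k, a k ≠ b k)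
    (hinj : Function.Injective fun k => s(a k, b k)) (σ : Fin s → Equiv.Perm (Fin m))
    (k : Fin s) : tupleVoltage a b σ (b k) (a k) = (σ k)⁻¹ :=
  (orientedEdges_injective hab hinj).extend_apply _ _ (Sum.inr k)

theorem tupleVoltage_of_ne (σ : Fin s → Equiv.Perm (Fin m)) {v w : V}
    (h : ∀ k, s(v, w) ≠ s(a k, b k)) : tupleVoltage a b σ v w = 1 := by
  refine Function.extend_apply' _ _ _ ?_
  rintro ⟨k | k, hk⟩ <;> simp only [orientedEdges, Sum.elim_inl, Sum.elim_inr,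
    Prod.mk.injEq] at hk <;> exact h k (by simp [hk])

theorem tupleVoltage_swap (hab : ∀ k, a k ≠ b k)
    (hinj : Function.Injective fun k => s(a k, b k)) (σ : Fin s → Equiv.Perm (Fin m)) (v w : V) :
    tupleVoltage a b σ w v = (tupleVoltage a b σ v w)⁻¹ := by
  by_cases h : ∃ k, s(v, w) = s(a k, b k)
  · obtain ⟨k, hk⟩ := h
    rcases Sym2.eq_iff.mp hk with ⟨rfl, rfl⟩ | ⟨rfl, rfl⟩ <;>
      simp [tupleVoltage_apply hab hinj, tupleVoltage_apply_swap hab hinj]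
  · push Not at h
    rw [tupleVoltage_of_ne σ h, tupleVoltage_of_ne σ (by simpa [Sym2.eq_swap] using h), inv_one]

/-- Two tuples of permutations give isomorphic coverings exactly when they are simultaneously
conjugate: the permutation of the sheets induced by an isomorphism is the same over all vertices,
because it does not change along the edges of the spanning tree. -/
theorem tupleVoltage_iso_iff {r : V} {par : V → V}
    (hpar : ∀ v, v ≠ r → G.Adj v (par v) ∧ G.dist (par v) r < G.dist v r)
    (hab : ∀ k, G.Adj (a k) (b k)) (hinj : Function.Injective fun k => s(a k, b k))
    (htree : ∀ k v, v ≠ r → s(v, par v) ≠ s(a k, b k)) (hm : 0 < m)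
    (σ σ' : Fin s → Equiv.Perm (Fin m)) :
    coveringIso G m
        (voltageCovering G hm (tupleVoltage a b σ)
          (tupleVoltage_swap (fun k => (hab k).ne) hinj σ))
        (voltageCovering G hm (tupleVoltage a b σ')
          (tupleVoltage_swap (fun k => (hab k).ne) hinj σ')) ↔
      simConj s m σ σ' := by
  have hab' := fun k => (hab k).ne
  constructor
  · intro h
    obtain ⟨τ, hτ⟩ := exists_perm_of_voltageCovering_iso h
    have hconst : ∀ v, τ v = τ r := by
      refine parent_induction hpar rfl fun v hv ih => ?_
      rw [← ih]
      ext i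
      have := hτ v (par v) (hpar v hv).1 i
      rw [tupleVoltage_of_ne _ fun k => htree k v hv,
        tupleVoltage_of_ne _ fun k => htree k v hv] at this
      simpa using congrArg Fin.val this
    refine ⟨τ r, fun k => Equiv.ext fun i => ?_⟩
    have := hτ (a k) (b k) (hab k) ((τ r)⁻¹ i)
    rw [tupleVoltage_apply hab' hinj, tupleVoltage_apply hab' hinj, hconst (a k),
      hconst (b k)] at this
    simpa using this
  · rintro ⟨τ, hτ⟩
    refine voltageCovering_iso (fun _ => τ) fun v w hvw i => ?_
    by_cases h : ∃ k, s(v, w) = s(a k, b k)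
    · obtain ⟨k, hk⟩ := h
      rcases Sym2.eq_iff.mp hk with ⟨rfl, rfl⟩ | ⟨rfl, rfl⟩
      · simp [tupleVoltage_apply hab' hinj, hτ]
      · simp [tupleVoltage_apply_swap hab' hinj, hτ]
    · push Not at h
      simp [tupleVoltage_of_ne _ h]

/-! ### Every covering is given by a tuple of permutations -/

theorem GraphCovering.eq_of_adj (p : GraphCovering G m) {x y z : p.vertices}
    (hy : p.graph.Adj x y) (hz : p.graph.Adj x z) (h : p.proj y = p.proj z) : y = z :=
  (p.bijOn x).injOn hy hz h

theorem GraphCovering.nonempty_equiv_fiber (p : GraphCovering G m) (v : V) :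
    Nonempty (Fin m ≃ {x // p.proj x = v}) := by
  have hfin : (p.proj ⁻¹' {v}).Finite := Set.finite_of_encard_eq_coe (p.fold v)
  have : Finite {x // p.proj x = v} := hfin.to_subtype
  refine ⟨(finCongr ?_).trans (Finite.equivFin _).symm⟩
  have h := p.fold v
  rw [← hfin.cast_ncard_eq, Nat.cast_inj] at h
  exact h.symm

/-- Lifting the edge from `v` to `w` gives a bijection between the fibres; if there is no such edge,
an arbitrary bijection is taken. -/
theorem GraphCovering.exists_fiber_transport (p : GraphCovering G m) (v w : V) :
    ∃ θ : {x // p.proj x = v} ≃ {x // p.proj x = w},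
      G.Adj v w → ∀ x : {x // p.proj x = v}, p.graph.Adj (x : p.vertices) (θ x : p.vertices) := by
  by_cases h : G.Adj v w
  · have hlift : ∀ (v w : V), G.Adj v w → ∀ x : {x // p.proj x = v},
        ∃ y : {x // p.proj x = w}, p.graph.Adj x (y : p.vertices) := by
      rintro v w h ⟨x, rfl⟩
      obtain ⟨y, hy, hyw⟩ := (p.bijOn x).surjOn h
      exact ⟨⟨y, hyw⟩, hy⟩
    choose f hf using hlift v w h
    choose g hg using hlift w v h.symm
    refine ⟨⟨f, g, fun x => Subtype.ext ?_, fun y => Subtype.ext ?_⟩, fun _ => hf⟩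
    · exact p.eq_of_adj (hg _) (hf x).symm ((g (f x)).2.trans x.2.symm)
    · exact p.eq_of_adj (hf _) (hg y).symm ((f (g y)).2.trans y.2.symm)
  · exact ⟨(p.nonempty_equiv_fiber v).some.symm.trans (p.nonempty_equiv_fiber w).some,
      fun h' => absurd h' h⟩

/-- Sheets are numbered over the root and the numbering is carried along the spanning tree, which
makes the voltages of its edges trivial. -/
theorem exists_tupleVoltage_iso {r : V} {par : V → V}
    (hpar : ∀ v, v ≠ r → G.Adj v (par v) ∧ G.dist (par v) r < G.dist v r)
    (hab : ∀ k, G.Adj (a k) (b k)) (hinj : Function.Injective fun k => s(a k, b k))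
    (htree : ∀ k v, v ≠ r → s(v, par v) ≠ s(a k, b k))
    (hcover : ∀ v w, G.Adj v w →
      (∃ u, u ≠ r ∧ s(v, w) = s(u, par u)) ∨ ∃ k, s(v, w) = s(a k, b k))
    (hm : 0 < m) (p : GraphCovering G m) :
    ∃ σ : Fin s → Equiv.Perm (Fin m), coveringIso G m
        (voltageCovering G hm (tupleVoltage a b σ)
          (tupleVoltage_swap (fun k => (hab k).ne) hinj σ)) p := by
  have hab' := fun k => (hab k).ne
  choose θ hθ using p.exists_fiber_transport
  obtain ⟨ψ, hψ⟩ := exists_parent_recursion hpar (F := fun v => Fin m ≃ {x // p.proj x = v})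
    (fun v => (p.nonempty_equiv_fiber v).some) fun v w e => e.trans (θ v w)
  let σ : Fin s → Equiv.Perm (Fin m) := fun k =>
    ((ψ (a k)).trans (θ (a k) (b k))).trans (ψ (b k)).symm
  let α := tupleVoltage a b σ
  have hα : ∀ v w, α w v = (α v w)⁻¹ := tupleVoltage_swap hab' hinj σ
  -- It is enough to see that each sheet is joined to the one predicted by the voltage.
  have huniq : ∀ v w, (∀ i, p.graph.Adj (ψ v i) (ψ w (α v w i) : p.vertices)) →
      ∀ i j, p.graph.Adj (ψ v i) (ψ w j : p.vertices) ↔ j = α v w i := by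
    intro v w h i j
    refine ⟨fun hj => ?_, fun hj => hj ▸ h i⟩
    have := p.eq_of_adj hj (h i) ((ψ w _).2.trans (ψ w _).2.symm)
    exact (ψ w).injective (Subtype.ext this)
  have hswap : ∀ v w, (∀ i, p.graph.Adj (ψ v i) (ψ w (α v w i) : p.vertices)) →
      ∀ i, p.graph.Adj (ψ w i) (ψ v (α w v i) : p.vertices) := by
    intro v w h i
    have := (h (α w v i)).symm
    rw [hα w v] at this
    simpa using this
  have hpart : ∀ u, u ≠ r → ∀ i,
      p.graph.Adj (ψ (par u) i) (ψ u (α (par u) u i) : p.vertices) := by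
    intro u hu i
    have h1 : α (par u) u = 1 :=
      tupleVoltage_of_ne σ fun k => by rw [Sym2.eq_swap]; exact htree k u hu
    rw [h1, hψ u hu]
    exact hθ _ _ (hpar u hu).1.symm _
  have hedge : ∀ k i, p.graph.Adj (ψ (a k) i) (ψ (b k) (α (a k) (b k) i) : p.vertices) := by
    intro k i
    have h1 : α (a k) (b k) = σ k := tupleVoltage_apply hab' hinj σ k
    rw [h1]
    simpa [σ] using hθ _ _ (hab k) (ψ (a k) i)
  have hadj : ∀ v w, G.Adj v w → ∀ i, p.graph.Adj (ψ v i) (ψ w (α v w i) : p.vertices) := by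
    intro v w hvw
    rcases hcover v w hvw with ⟨u, hu, h⟩ | ⟨k, h⟩
    · rcases Sym2.eq_iff.mp h with ⟨rfl, rfl⟩ | ⟨rfl, rfl⟩
      · exact hswap _ _ (hpart v hu)
      · exact hpart w hu
    · rcases Sym2.eq_iff.mp h with ⟨rfl, rfl⟩ | ⟨rfl, rfl⟩
      · exact hedge k
      · exact hswap _ _ (hedge k)
  let Φ : V × Fin m ≃ p.vertices :=
    (Equiv.sigmaEquivProd V (Fin m)).symm.trans
      ((Equiv.sigmaCongrRight ψ).trans (Equiv.sigmaFiberEquiv p.proj))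
  have hΦ : ∀ x, p.proj (Φ x) = x.1 := fun x => (ψ x.1 x.2).2
  refine ⟨σ, ⟨Φ, ?_⟩, hΦ⟩
  rintro ⟨v, i⟩ ⟨w, j⟩
  change p.graph.Adj (ψ v i) (ψ w j : p.vertices) ↔ G.Adj v w ∧ j = α v w i
  constructor
  · intro h
    have hvw : G.Adj v w := by
      have := (p.bijOn (ψ v i)).mapsTo h
      rwa [(ψ w j).2, (ψ v i).2] at this
    exact ⟨hvw, (huniq v w (hadj v w hvw) i j).mp h⟩
  · rintro ⟨hvw, rfl⟩
    exact hadj v w hvw i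

theorem nonempty_permClass_equiv_coveringClass [Finite V] (hG : G.Connected)
    (hs : bettiNumber G = s) (hm : 0 < m) :
    Nonempty (PermClass s m ≃ CoveringClass G m) := by
  obtain ⟨r⟩ := hG.nonempty
  obtain ⟨par, hpar⟩ := exists_parent hG r
  obtain ⟨a, b, hab, hinj, htree, hcover⟩ := exists_cotree_edges hs hpar
  have hiff := tupleVoltage_iso_iff hpar hab hinj htree hm
  refine ⟨Equiv.ofBijective (Quotient.map
    (fun σ => voltageCovering G hm (tupleVoltage a b σ)
      (tupleVoltage_swap (fun k => (hab k).ne) hinj σ))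
    fun σ σ' h => (hiff σ σ').mpr h) ⟨?_, ?_⟩⟩
  · rintro ⟨σ⟩ ⟨σ'⟩ h
    exact Quotient.sound ((hiff σ σ').mp (Quotient.exact h))
  · rintro ⟨p⟩
    obtain ⟨σ, hσ⟩ := exists_tupleVoltage_iso hpar hab hinj htree hcover hm p
    exact ⟨Quotient.mk _ σ, Quotient.sound hσ⟩

end Coverings

end Entanglement

open Entanglement in
theorem theorem1 {s : ℕ} (n : Fin (s + 1) → ℕ) (hn : ∀ k, 0 < n k) (m : ℕ) :
    Submodule.span ℂ (Set.range fun c : PermClass s m => classInvariant n c) =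
        invariantRealPoly (tensorRep n) (2 * m) ∧
      (0 < m → ∀ (V : Type*) [Finite V] (G : SimpleGraph V),
        G.Connected → bettiNumber G = s →
          Nonempty (PermClass s m ≃ CoveringClass G m)) :=
  ⟨span_classInvariant n m, fun hm _ _ _ hG hs => nonempty_permClass_equiv_coveringClass hG hs hm⟩
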